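/- Multigraphs are finite and may have loops and multiple edges; a loop contributes $2$ to the degree of its vertex. A multigraph is cubic if every vertex has degree $3$, a cut-edge is an edge whose deletion increases the number of components, and $f_2(G)$ denotes the maximum number of vertices in a $2$-regular subgraph of $G$ (with $f_2(G)=0$ if $G$ has no nonempty $2$-regular subgraph). **Theorem 1.** If $G$ is a cubic multigraph with $n$ vertices and exactly $c$ cut-edges, then $$f_2(G)\ \ge\ n-\max\left\{0,\left\lfloor\frac{c-1}{2}\right\rfloor\right\}.$$ This bound is sharp: for every even $n$ and every integer $c$ with $0\le c<n$ there is a cubic multigraph with $n$ vertices and exactly $c$ cut-edges for which equality holds. -/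

import Mathlib

namespace Graph

/-- The degree of a vertex of a multigraph: the number of edges incident to it, with every loop
counted twice. -/
noncomputable def degree {α β : Type*} (G : Graph α β) (x : α) : ℕ :=
  (G.incidenceSet x).ncard + (G.loopSet x).ncard

/-- A multigraph is `k`-regular if each of its vertices has degree `k`. -/
def IsRegular {α β : Type*} (G : Graph α β) (k : ℕ) : Prop :=
  ∀ x ∈ G.vertexSet, G.degree x = k

/-- An edge is a cut-edge if its ends lie in different components once it is deleted. -/
def IsCutEdge {α β : Type*} (G : Graph α β) (e : β) : Prop :=
  ∃ x y, G.IsLink e x y ∧ ¬ Relation.ReflTransGen (G.deleteEdges {e}).Adj x y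

/-- The set of cut-edges of a multigraph. -/
def cutEdgeSet {α β : Type*} (G : Graph α β) : Set β :=
  {e | G.IsCutEdge e}

/-- The maximum number of vertices in a `k`-regular subgraph. The subgraph without vertices is
`k`-regular, so this is `0` if there is no other one. -/
noncomputable def maxRegular {α β : Type*} (k : ℕ) (G : Graph α β) : ℕ :=
  sSup {m | ∃ H : Graph α β, H ≤ G ∧ H.IsRegular k ∧ H.vertexSet.ncard = m}

/-- In a multigraph with finitely many vertices, the maximum is attained. -/
theorem isGreatest_maxRegular {α β : Type*} (k : ℕ) (G : Graph α β) (hV : G.vertexSet.Finite) :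
    IsGreatest {m | ∃ H : Graph α β, H ≤ G ∧ H.IsRegular k ∧ H.vertexSet.ncard = m}
      (G.maxRegular k) := by
  have hb : BddAbove {m | ∃ H : Graph α β, H ≤ G ∧ H.IsRegular k ∧ H.vertexSet.ncard = m} := by
    refine ⟨G.vertexSet.ncard, ?_⟩
    rintro m ⟨H, hH, -, rfl⟩
    exact Set.ncard_le_ncard hH.1 hV
  refine ⟨Nat.sSup_mem ⟨0, ⊥, bot_le, ?_, ?_⟩ hb, fun m hm => le_csSup hb hm⟩
  · intro x hx
    simp at hx
  · simp

end Graph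

/-!
Modulo 2, a set of edges of a multigraph is a chain with a boundary, namely the set of vertices at
which it has odd degree. In a cubic multigraph the sets `F` of edges without boundary are exactly
the edge sets of `2`-regular subgraphs, and such a subgraph has as many vertices as edges. So
`f₂(G)` is the largest size of an even set of edges; equivalently, the complement of such a set is a
minimum join for the set of all vertices.

**Bridgeless multigraphs** (`EdgeChain.exists_even_subset`). A bridgeless multigraph with `m` edges
has an even set of at least `2m/3` edges. This comes from a theorem on minimum joins: if `J` is
minimum among the subsets of `A` with the same boundary, and every cut that meets `J` in an odd
number of edges has at least three edges, then `3 |J| ≤ |A|`. Subdividing every edge once reduces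
it to bipartite multigraphs. There, following Sebő's proof of Seymour's theorem, some vertex `v` has
exactly one edge in every minimum join with the boundary of `J`
(`EdgeChain.exists_vertex_card_eq_one`): take `v` to be an end of a pair `{x, v}` of vertices for
which adding `x` and `v` to the boundary lowers the minimum size the most. Contracting `v` together
with its neighbours to one vertex keeps the rest of `J` minimum
(`EdgeChain.isMinJoin_contract`), and loses one edge of `J` and at least three edges in all.

**Cut-edges** (`EdgeChain.exists_even_subset_of_cubic`). Delete the cut-edges of a cubic multigraph.
A component with `n'` vertices and `k` ends of cut-edges has `(3n' - k) / 2` edges and no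
cut-edge, so it has an even set of at least `n' - k / 3` edges, hence one that misses at most
`⌊k / 3⌋` vertices. That is at most `(k - 1) / 2` if `k > 0`, and `0` if `k = 0`. The sum of the `k`
is `2c`, and as the cut-edges form a forest on the components, more than `c` components have `k > 0`
when `c > 0`. So at most `(2c - (c + 1)) / 2 = (c - 1) / 2` vertices are missed in total.

**Sharpness** (`Graph.extremal`). A `2`-regular subgraph has no cut-edge, so it misses each vertex
with three cut-edges. In a caterpillar whose inner vertices all have degree `3`, with a loop at each
leaf, the number of such vertices is `(c - 1) / 2`. A dumbbell component adjusts the parity of `c`,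
and components with two vertices and three parallel edges adjust `n`.
-/

set_option linter.unusedSectionVars false

/-! ### Chains of edges modulo 2 -/

namespace EdgeChain

open Finset
open scoped symmDiff

variable {V E : Type*} [Fintype V] [DecidableEq V] [DecidableEq E]

/-- The boundary of the set `S` of edges in the multigraph whose edge `e` has the ends `s e` and
`t e`: the degree in `S` of each vertex, modulo 2. A loop contributes `0`. -/
def bdry (s t : E → V) (S : Finset E) : V → ZMod 2 :=
  ∑ e ∈ S, (Pi.single (s e) 1 + Pi.single (t e) 1)

variable (s t : E → V)

theorem bdry_apply (S : Finset E) (v : V) :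
    bdry s t S v = ∑ e ∈ S, ((if s e = v then 1 else 0) + (if t e = v then 1 else 0)) := by
  simp only [bdry, Finset.sum_apply, Pi.add_apply, Pi.single_apply, eq_comm]

@[simp] theorem bdry_empty : bdry s t ∅ = 0 := by simp [bdry]

theorem bdry_singleton (e : E) : bdry s t {e} = Pi.single (s e) 1 + Pi.single (t e) 1 := by
  simp [bdry]

/-- The pairing of a boundary with `g`. Every parity argument about cuts or classes of vertices
goes through it. -/
theorem sum_mul_bdry (g : V → ZMod 2) (S : Finset E) :
    ∑ v, g v * bdry s t S v = ∑ e ∈ S, (g (s e) + g (t e)) := by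
  simp only [bdry_apply, Finset.mul_sum]
  rw [Finset.sum_comm]
  refine Finset.sum_congr rfl fun e _ => ?_
  simp [mul_add, Finset.sum_add_distrib]

theorem add_eq_ite (a b : ZMod 2) : a + b = if a ≠ b then 1 else 0 := by
  revert a b; decide

/-- A cut is given by a function `g : V → ZMod 2`; an edge crosses it if `g` differs at its ends. -/
theorem card_cut (g : V → ZMod 2) (S : Finset E) :
    (#{e ∈ S | g (s e) ≠ g (t e)} : ZMod 2) = ∑ v, g v * bdry s t S v := by
  rw [sum_mul_bdry, Finset.card_filter]
  push_cast
  exact Finset.sum_congr rfl fun e _ => (add_eq_ite _ _).symm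

theorem even_card_cut {S : Finset E} (h : bdry s t S = 0) (g : V → ZMod 2) :
    Even #{e ∈ S | g (s e) ≠ g (t e)} := by
  rw [← ZMod.natCast_eq_zero_iff_even, card_cut, h]
  simp

theorem bdry_union {S R : Finset E} (h : Disjoint S R) :
    bdry s t (S ∪ R) = bdry s t S + bdry s t R := Finset.sum_union h

theorem add_self_fun (a : V → ZMod 2) : a + a = 0 := by
  ext v; exact CharTwo.add_self_eq_zero _

theorem bdry_symmDiff (S R : Finset E) : bdry s t (S ∆ R) = bdry s t S + bdry s t R := by
  have h1 : bdry s t S = bdry s t (S \ R) + bdry s t (S ∩ R) := by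
    rw [← bdry_union s t (Finset.disjoint_sdiff_inter S R), Finset.sdiff_union_inter]
  have h2 : bdry s t R = bdry s t (R \ S) + bdry s t (S ∩ R) := by
    rw [Finset.inter_comm, ← bdry_union s t (Finset.disjoint_sdiff_inter R S),
      Finset.sdiff_union_inter]
  have h3 : bdry s t (S ∆ R) = bdry s t (S \ R) + bdry s t (R \ S) :=
    bdry_union s t (disjoint_sdiff_sdiff)
  rw [h3, h1, h2, add_add_add_comm, add_self_fun, add_zero]

theorem bdry_sdiff {S R : Finset E} (h : R ⊆ S) :
    bdry s t (S \ R) = bdry s t S + bdry s t R := by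
  rw [← bdry_symmDiff, symmDiff_of_ge (show R ≤ S from h)]

theorem bdry_erase {S : Finset E} {e : E} (h : e ∈ S) :
    bdry s t (S.erase e) = bdry s t S + (Pi.single (s e) 1 + Pi.single (t e) 1) := by
  rw [← Finset.sdiff_singleton_eq_erase, bdry_sdiff s t (by simpa using h), bdry_singleton]

theorem bdry_insert {S : Finset E} {e : E} (h : e ∉ S) :
    bdry s t (insert e S) = bdry s t S + (Pi.single (s e) 1 + Pi.single (t e) 1) := by
  rw [bdry, Finset.sum_insert h, add_comm]; rfl

theorem bdry_eq_zero_of_forall {S : Finset E} {v : V} (h : ∀ e ∈ S, s e ≠ v ∧ t e ≠ v) :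
    bdry s t S v = 0 := by
  rw [bdry_apply]
  exact Finset.sum_eq_zero fun e he => by simp [h e he]

/-- Some subset of `S` has the boundary `x + y`. As chains add, this is the relation of lying in the
same component of `S`, without walks. -/
def JoinedBy (S : Finset E) (x y : V) : Prop :=
  ∃ R ⊆ S, bdry s t R = Pi.single x 1 + Pi.single y 1

variable {s t}

theorem JoinedBy.refl (S : Finset E) (x : V) : JoinedBy s t S x x :=
  ⟨∅, by simp, by rw [bdry_empty, add_self_fun]⟩

theorem JoinedBy.symm {S : Finset E} {x y : V} (h : JoinedBy s t S x y) : JoinedBy s t S y x := by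
  obtain ⟨R, hR, h⟩ := h
  exact ⟨R, hR, by rw [h, add_comm]⟩

theorem JoinedBy.trans {S : Finset E} {x y z : V} (h : JoinedBy s t S x y) (h' : JoinedBy s t S y z) :
    JoinedBy s t S x z := by
  obtain ⟨R, hR, h⟩ := h
  obtain ⟨R', hR', h'⟩ := h'
  refine ⟨R ∆ R', symmDiff_le_sup.trans (Finset.union_subset hR hR'), ?_⟩
  rw [bdry_symmDiff, h, h', add_assoc, ← add_assoc (Pi.single y 1), add_self_fun, zero_add]

theorem JoinedBy.of_mem {S : Finset E} {e : E} (h : e ∈ S) : JoinedBy s t S (s e) (t e) :=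
  ⟨{e}, by simpa using h, bdry_singleton s t e⟩

/-- The part of `S` that is joined to `z` has an even number of vertices of odd degree. -/
theorem exists_joined_of_bdry_ne_zero {S : Finset E} {z : V} (hz : bdry s t S z ≠ 0) :
    ∃ z', z' ≠ z ∧ bdry s t S z' ≠ 0 ∧ JoinedBy s t S z z' := by
  classical
  by_contra! hcon
  have h := sum_mul_bdry s t (fun u => if JoinedBy s t S z u then (1 : ZMod 2) else 0) S
  rw [Finset.sum_eq_zero (s := S), Finset.sum_eq_single z] at h
  · simp [JoinedBy.refl, hz] at h
  · intro u _ hu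
    by_cases hb : bdry s t S u = 0
    · simp [hb]
    · simp [hcon u hu hb]
  · simp
  · intro e he
    have : JoinedBy s t S z (s e) ↔ JoinedBy s t S z (t e) :=
      ⟨fun h => h.trans (.of_mem he), fun h => h.trans (JoinedBy.of_mem he).symm⟩
    simp only [this]
    exact CharTwo.add_self_eq_zero _

end EdgeChain

/-! ### A vertex with one edge in every minimum join -/

namespace EdgeChain

open Finset
open scoped symmDiff

variable {V E : Type*} [Fintype V] [DecidableEq V] [DecidableEq E]

/-- `J` is a minimum join in `A`: it has the least size among the subsets of `A` with its
boundary. -/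
def IsMinJoin (s t : E → V) (A J : Finset E) : Prop :=
  J ⊆ A ∧ ∀ K ⊆ A, bdry s t K = bdry s t J → #J ≤ #K

variable {s t : E → V}

/-- An exchange: each edge of `C` lies in exactly one of `J` and `K`, and is moved to the other. -/
theorem card_symmDiff_add_card_symmDiff {J K C : Finset E} (h : C ⊆ J ∆ K) :
    #(J ∆ C) + #(K ∆ C) = #J + #K := by
  have key : ∀ X : Finset E, #(X ∆ C) = #(X \ C) + #(C \ X) := fun X =>
    Finset.card_union_of_disjoint disjoint_sdiff_sdiff
  have h1 := Finset.card_sdiff_add_card_inter J C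
  have h2 := Finset.card_sdiff_add_card_inter K C
  have e1 : C \ J = K ∩ C := by
    ext e
    have := @h e
    simp only [Finset.mem_symmDiff, Finset.mem_sdiff, Finset.mem_inter] at *
    tauto
  have e2 : C \ K = J ∩ C := by
    ext e
    have := @h e
    simp only [Finset.mem_symmDiff, Finset.mem_sdiff, Finset.mem_inter] at *
    tauto
  rw [key, key, e1, e2]
  omega

theorem exists_other_end {e : E} {v : V} (h : s e = v ∨ t e = v) (hl : s e ≠ t e) :
    ∃ z, z ≠ v ∧ (Pi.single (s e) 1 + Pi.single (t e) 1 : V → ZMod 2) =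
      Pi.single v 1 + Pi.single z 1 := by
  rcases h with rfl | rfl
  · exact ⟨t e, hl.symm, rfl⟩
  · exact ⟨s e, hl, add_comm _ _⟩

/-- A set of edges with boundary `{x, v}` and two edges at `v` contains a cycle through `v`. -/
theorem exists_cycle_of_two_edges {P : Finset E} {x v : V} (hxv : x ≠ v)
    (hP : bdry s t P = Pi.single x 1 + Pi.single v 1) {f₁ f₂ : E} (h₁ : f₁ ∈ P) (h₂ : f₂ ∈ P)
    (hne : f₁ ≠ f₂) (hv₁ : s f₁ = v ∨ t f₁ = v) (hv₂ : s f₂ = v ∨ t f₂ = v)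
    (hl₁ : s f₁ ≠ t f₁) (hl₂ : s f₂ ≠ t f₂) :
    ∃ C ⊆ P, bdry s t C = 0 ∧ (f₁ ∈ C ∨ f₂ ∈ C) := by
  obtain ⟨z₁, hz₁, e₁⟩ := exists_other_end hv₁ hl₁
  obtain ⟨z₂, hz₂, e₂⟩ := exists_other_end hv₂ hl₂
  have hS : bdry s t ((P.erase f₁).erase f₂) = Pi.single x 1 + Pi.single v 1 +
      (Pi.single v 1 + Pi.single z₁ 1) + (Pi.single v 1 + Pi.single z₂ 1) := by
    rw [bdry_erase s t (Finset.mem_erase.2 ⟨hne.symm, h₂⟩), bdry_erase s t h₁, hP, e₁, e₂]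
  have hSv : bdry s t ((P.erase f₁).erase f₂) v ≠ 0 := by
    rw [hS]
    simp [hxv.symm, hz₁.symm, hz₂.symm]
    decide
  -- without `f₁` and `f₂`, the vertex `v` is still joined to `x` or to the other end of `f₁` or `f₂`
  obtain ⟨u, huv, hu, R, hR, hRb⟩ := exists_joined_of_bdry_ne_zero hSv
  have hRP : R ⊆ P := hR.trans ((Finset.erase_subset _ _).trans (Finset.erase_subset _ _))
  have hf₁ : f₁ ∉ R := fun h => by simpa using hR h
  have hf₂ : f₂ ∉ R := fun h => by simpa using hR h
  have hcase : u = z₁ ∨ u = z₂ ∨ u = x := by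
    by_contra! hc
    apply hu
    rw [hS]
    simp [hc, huv]
  rcases hcase with rfl | rfl | rfl
  · refine ⟨insert f₁ R, Finset.insert_subset h₁ hRP, ?_, .inl (by simp)⟩
    rw [bdry_insert s t hf₁, hRb, e₁, add_self_fun]
  · refine ⟨insert f₂ R, Finset.insert_subset h₂ hRP, ?_, .inr (by simp)⟩
    rw [bdry_insert s t hf₂, hRb, e₂, add_self_fun]
  · refine ⟨P \ R, Finset.sdiff_subset, ?_, .inl (by simp [h₁, hf₁])⟩
    rw [bdry_sdiff s t hRP, hRb, hP, add_comm (Pi.single v 1), add_self_fun]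

/-- Choose `K` of least size among the sets with boundary `∂J + x + v`, where `x ≠ v`. If a minimum
join `J'` with boundary `∂J` had two edges at `v`, a cycle in `J' ∆ K` through one of them could be
exchanged between `J'` and `K`, which would put an edge at `v` into a minimum `K`. -/
theorem exists_vertex_card_eq_one {A J : Finset E} (hA : ∀ e ∈ A, s e ≠ t e)
    (hJ : IsMinJoin s t A J) (hne : J.Nonempty) :
    ∃ v, ∀ J', IsMinJoin s t A J' → bdry s t J' = bdry s t J →
      #{e ∈ J' | s e = v ∨ t e = v} = 1 := by
  classical
  obtain ⟨e, he⟩ := hne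
  let good : Finset E → Prop := fun K =>
    K ⊆ A ∧ ∃ x v, x ≠ v ∧ bdry s t K = bdry s t J + (Pi.single x 1 + Pi.single v 1)
  have hgood : good (J.erase e) := ⟨(Finset.erase_subset _ _).trans hJ.1, s e, t e,
    hA e (hJ.1 he), bdry_erase s t he⟩
  obtain ⟨K, hK, hmin⟩ : ∃ K, good K ∧ ∀ K', good K' → #K ≤ #K' := by
    have hex : ∃ n K, good K ∧ #K = n := ⟨_, _, hgood, rfl⟩
    obtain ⟨K, hK, hc⟩ := Nat.find_spec hex
    exact ⟨K, hK, fun K' hK' => hc ▸ Nat.find_min' hex ⟨K', hK', rfl⟩⟩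
  obtain ⟨hKA, x, v, hxv, hKb⟩ := hK
  have hKJ : #K < #J := by
    have := hmin _ hgood
    rw [Finset.card_erase_of_mem he] at this
    have : 0 < #J := Finset.card_pos.2 ⟨e, he⟩
    omega
  -- a minimum chain `K'` has no edge at `v`, for dropping such an edge gives a smaller chain
  have hfree : ∀ K' ⊆ A, bdry s t K' = bdry s t K → #K' ≤ #K →
      ∀ f ∈ K', ¬ (s f = v ∨ t f = v) := by
    intro K' hK'A hK'b hK'c f hf hfv
    obtain ⟨z, hzv, hz⟩ := exists_other_end hfv (hA f (hK'A hf))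
    have hb : bdry s t (K'.erase f) = bdry s t J + (Pi.single x 1 + Pi.single z 1) := by
      rw [bdry_erase s t hf, hK'b, hKb, hz, add_assoc, add_assoc,
        ← add_assoc (Pi.single v 1) (Pi.single v 1), add_self_fun, zero_add]
    have hsub : K'.erase f ⊆ A := (Finset.erase_subset _ _).trans hK'A
    have hc : #(K'.erase f) < #K' := Finset.card_erase_lt_of_mem hf
    by_cases hxz : x = z
    · subst hxz
      rw [add_self_fun, add_zero] at hb
      have := hJ.2 _ hsub hb
      omega
    · have := hmin _ ⟨hsub, x, z, hxz, hb⟩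
      omega
  refine ⟨v, fun J' hJ' hb => ?_⟩
  have hKv : bdry s t K v = 0 :=
    bdry_eq_zero_of_forall s t fun f hf => not_or.1 (hfree K hKA rfl le_rfl f hf)
  have hJ'v : bdry s t J' v ≠ 0 := by
    intro h0
    rw [hKb] at hKv
    simp [← hb, h0, hxv.symm] at hKv
  have hpos : {e ∈ J' | s e = v ∨ t e = v}.Nonempty := by
    by_contra! h
    rw [Finset.filter_eq_empty_iff] at h
    exact hJ'v (bdry_eq_zero_of_forall s t fun f hf => not_or.1 (h hf))
  by_contra hcard
  have hlt : 1 < #{e ∈ J' | s e = v ∨ t e = v} := by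
    have := hpos.card_pos
    omega
  obtain ⟨f₁, h₁, f₂, h₂, hne⟩ := Finset.one_lt_card.1 hlt
  rw [Finset.mem_filter] at h₁ h₂
  have hfK : ∀ f ∈ J', (s f = v ∨ t f = v) → f ∈ J' ∆ K := fun f hf hfv =>
    Finset.mem_symmDiff.2 (.inl ⟨hf, fun hk => hfree K hKA rfl le_rfl f hk hfv⟩)
  have hPb : bdry s t (J' ∆ K) = Pi.single x 1 + Pi.single v 1 := by
    rw [bdry_symmDiff, hKb, hb, ← add_assoc, add_self_fun, zero_add]
  obtain ⟨C, hCP, hCb, hC⟩ := exists_cycle_of_two_edges hxv hPb (hfK f₁ h₁.1 h₁.2)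
    (hfK f₂ h₂.1 h₂.2) hne h₁.2 h₂.2 (hA _ (hJ'.1 h₁.1)) (hA _ (hJ'.1 h₂.1))
  have hCA : C ⊆ A := fun f hf => by
    rcases Finset.mem_symmDiff.1 (hCP hf) with h | h
    · exact hJ'.1 h.1
    · exact hKA h.1
  have hsum := card_symmDiff_add_card_symmDiff hCP
  have hsub : ∀ X ⊆ A, X ∆ C ⊆ A := fun X hX =>
    symmDiff_le_sup.trans (Finset.union_subset hX hCA)
  have h1 := hJ'.2 _ (hsub J' hJ'.1) (by rw [bdry_symmDiff, hCb, add_zero])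
  have h2 := hfree (K ∆ C) (hsub K hKA) (by rw [bdry_symmDiff, hCb, add_zero]) (by omega)
  have hmem : ∀ f ∈ C, (s f = v ∨ t f = v) → f ∈ K ∆ C := fun f hf hfv =>
    Finset.mem_symmDiff.2 (.inr ⟨hf, fun hk => hfree K hKA rfl le_rfl f hk hfv⟩)
  rcases hC with hC | hC
  · exact h2 f₁ (hmem _ hC h₁.2) h₁.2
  · exact h2 f₂ (hmem _ hC h₂.2) h₂.2

end EdgeChain

/-! ### Contracting a star of a bipartite multigraph -/

namespace EdgeChain

open Finset
open scoped symmDiff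

variable {V E : Type*} [Fintype V] [DecidableEq V] [DecidableEq E]

/-- The weight of `C` in which the edges of `J` count `-1` and all others `1`: the change of `#J`
when `J` is replaced by `J ∆ C`. -/
def wt (J C : Finset E) : ℤ := ∑ e ∈ C, if e ∈ J then -1 else 1

theorem card_symmDiff_eq (J C : Finset E) : (#(J ∆ C) : ℤ) = #J + wt J C := by
  have key : #(J ∆ C) = #(J \ C) + #(C \ J) := Finset.card_union_of_disjoint disjoint_sdiff_sdiff
  have h1 := Finset.card_sdiff_add_card_inter J C
  have h2 : wt J C = #(C \ J) - #(J ∩ C) := by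
    rw [wt, ← Finset.sum_sdiff (Finset.inter_subset_right : J ∩ C ⊆ C),
      Finset.sum_congr rfl (g := fun _ => (1 : ℤ)),
      Finset.sum_congr (s₁ := J ∩ C) rfl (g := fun _ => (-1 : ℤ))]
    · rw [Finset.sum_const, Finset.sum_const, Finset.sdiff_inter_self_right]
      simp
      ring
    · intro e he
      simp [(Finset.mem_inter.1 he).1]
    · intro e he
      simp only [Finset.mem_sdiff, Finset.mem_inter, not_and] at he
      rw [if_neg fun h => he.2 h he.1]
  rw [key, h2]
  push_cast
  omega

theorem wt_insert {J C : Finset E} {e : E} (h : e ∉ C) :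
    wt J (insert e C) = (if e ∈ J then -1 else 1) + wt J C := Finset.sum_insert h

theorem wt_sdiff {J C R : Finset E} (h : R ⊆ C) : wt J C = wt J (C \ R) + wt J R :=
  (Finset.sum_sdiff h).symm

theorem even_wt_sub_card (J C : Finset E) : Even (wt J C - #C) := by
  rw [Finset.card_eq_sum_ones]
  push_cast
  rw [wt, ← Finset.sum_sub_distrib]
  refine Finset.even_sum _ fun e _ => ?_
  split_ifs <;> decide

variable {s t : E → V} {A J : Finset E}

theorem IsMinJoin.wt_nonneg (hJ : IsMinJoin s t A J) {C : Finset E} (hC : C ⊆ A)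
    (hb : bdry s t C = 0) : 0 ≤ wt J C := by
  have h := hJ.2 (J ∆ C) (symmDiff_le_sup.trans (Finset.union_subset hJ.1 hC))
    (by rw [bdry_symmDiff, hb, add_zero])
  have := card_symmDiff_eq J C
  omega

theorem even_card_of_bipartite {col : V → ZMod 2} {C : Finset E}
    (hcol : ∀ e ∈ C, col (s e) ≠ col (t e)) (hb : bdry s t C = 0) : Even #C := by
  have h := even_card_cut s t hb col
  rwa [Finset.filter_true_of_mem hcol] at h

section Contraction

variable {col : V → ZMod 2} {v : V} {e : E}

/-- If the weight of the cycle `C` were `0`, then `J ∆ C` would be a minimum join with more than one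
edge at `v`; and the weight is even, as the multigraph is bipartite. -/
theorem two_le_wt_of_cycle (hcol : ∀ e ∈ A, col (s e) ≠ col (t e)) (hJ : IsMinJoin s t A J)
    (hv : ∀ J', IsMinJoin s t A J' → bdry s t J' = bdry s t J →
      #{e ∈ J' | s e = v ∨ t e = v} = 1)
    (he : e ∈ J) (hev : s e = v ∨ t e = v) {C : Finset E} (hC : C ⊆ A) (hb : bdry s t C = 0)
    (heC : e ∉ C) {f : E} (hf : f ∈ C) (hfv : s f = v ∨ t f = v) : 2 ≤ wt J C := by
  have h0 := hJ.wt_nonneg hC hb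
  have hne : wt J C ≠ 0 := by
    intro hz
    have hJC := card_symmDiff_eq J C
    have hbJC : bdry s t (J ∆ C) = bdry s t J := by rw [bdry_symmDiff, hb, add_zero]
    have hmin : IsMinJoin s t A (J ∆ C) :=
      ⟨symmDiff_le_sup.trans (Finset.union_subset hJ.1 hC), fun K hK hKb => by
        have := hJ.2 K hK (hKb.trans hbJC)
        omega⟩
    have h1 := hv _ hmin hbJC
    have h2 := hv J hJ rfl
    have hef : e ≠ f := fun h => heC (h ▸ hf)
    have hfJ : f ∉ J := fun hfJ => hef (Finset.card_le_one.1 h2.le e (by simp [he, hev]) f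
      (by simp [hfJ, hfv]))
    exact hef (Finset.card_le_one.1 h1.le e (by simp [Finset.mem_symmDiff, he, heC, hev]) f
      (by simp [Finset.mem_symmDiff, hf, hfJ, hfv]))
  have h3 := even_card_of_bipartite (fun e he => hcol e (hC he)) hb
  have h4 := even_wt_sub_card J C
  obtain ⟨a, ha⟩ := h3
  obtain ⟨b, hb'⟩ := h4
  omega

/-- Some edge of `A` has the ends `v` and `z`. -/
def Nbr (s t : E → V) (A : Finset E) (v z : V) : Prop :=
  ∃ f ∈ A, (s f = v ∧ t f = z) ∨ (s f = z ∧ t f = v)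

/-- A chain that joins two neighbours of `v` closes up to a cycle through `v`. The two edges at `v`
add `0` to the weight if `e` is one of them; otherwise they add `2`, but then the cycle has weight at
least `2`. -/
theorem wt_nonneg_of_joined_nbr (hcol : ∀ e ∈ A, col (s e) ≠ col (t e)) (hJ : IsMinJoin s t A J)
    (hv : ∀ J', IsMinJoin s t A J' → bdry s t J' = bdry s t J →
      #{e ∈ J' | s e = v ∨ t e = v} = 1)
    (he : e ∈ J) (hev : s e = v ∨ t e = v) {R : Finset E} (hR : R ⊆ A)
    (hRv : ∀ f ∈ R, ¬ (s f = v ∨ t f = v)) {z z' : V} (hzz : z ≠ z') (hz : Nbr s t A v z)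
    (hz' : Nbr s t A v z') (hb : bdry s t R = Pi.single z 1 + Pi.single z' 1) :
    0 ≤ wt J R := by
  have hJv : ∀ f ∈ J, (s f = v ∨ t f = v) → f = e := fun f hf hfv =>
    Finset.card_le_one.1 (hv J hJ rfl).le f (by simp [hf, hfv]) e (by simp [he, hev])
  have hpick : ∀ z, Nbr s t A v z → ∃ f ∈ A, (s f = v ∨ t f = v) ∧
      (Pi.single (s f) 1 + Pi.single (t f) 1 : V → ZMod 2) = Pi.single v 1 + Pi.single z 1 := by
    rintro z ⟨f, hf, (⟨h1, h2⟩ | ⟨h1, h2⟩)⟩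
    · exact ⟨f, hf, .inl h1, by rw [h1, h2]⟩
    · exact ⟨f, hf, .inr h2, by rw [h1, h2, add_comm]⟩
  obtain ⟨f, hfA, hfv, hf⟩ := hpick z hz
  obtain ⟨f', hfA', hfv', hf'⟩ := hpick z' hz'
  have hff : f ≠ f' := by
    rintro rfl
    have h := add_left_cancel (hf.symm.trans hf')
    have := congrFun h z
    simp [hzz] at this
  have hfR : f' ∉ R := fun h => hRv _ h hfv'
  have hfR' : f ∉ insert f' R := by
    simp only [Finset.mem_insert, not_or]
    exact ⟨hff, fun h => hRv _ h hfv⟩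
  have hCb : bdry s t (insert f (insert f' R)) = 0 := by
    rw [bdry_insert s t hfR', bdry_insert s t hfR, hb, hf, hf']
    ext w
    simp only [Pi.add_apply, Pi.zero_apply]
    generalize (Pi.single z 1 : V → ZMod 2) w = a
    generalize (Pi.single z' 1 : V → ZMod 2) w = b
    generalize (Pi.single v 1 : V → ZMod 2) w = c
    revert a b c
    decide
  have hCA : insert f (insert f' R) ⊆ A :=
    Finset.insert_subset hfA (Finset.insert_subset hfA' hR)
  have hw : wt J (insert f (insert f' R)) = (if f ∈ J then -1 else 1) +
      ((if f' ∈ J then -1 else 1) + wt J R) := by rw [wt_insert hfR', wt_insert hfR]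
  by_cases heC : e ∈ insert f (insert f' R)
  · have h0 := hJ.wt_nonneg hCA hCb
    rw [hw] at h0
    by_cases h1 : f ∈ J
    · by_cases h2 : f' ∈ J
      · exact absurd ((hJv f h1 hfv).trans (hJv f' h2 hfv').symm) hff
      · simp only [h1, h2, if_true, if_false] at h0
        omega
    · by_cases h2 : f' ∈ J
      · simp only [h1, h2, if_true, if_false] at h0
        omega
      · exfalso
        simp only [Finset.mem_insert] at heC
        rcases heC with rfl | rfl | h
        · exact h1 he
        · exact h2 he
        · exact hRv _ h hev
  · have h2 := two_le_wt_of_cycle hcol hJ hv he hev hCA hCb heC (Finset.mem_insert_self _ _) hfv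
    have h3 : f ∉ J := fun h => heC (by simp [← hJv f h hfv])
    have h4 : f' ∉ J := fun h => heC (by simp [← hJv f' h hfv'])
    rw [hw] at h2
    simp only [h3, h4, if_false] at h2
    omega

/-- A set of edges that becomes even when the neighbours of `v` are identified splits into cycles
and chains between neighbours of `v`. -/
theorem wt_nonneg_of_bdry_nbr (hcol : ∀ e ∈ A, col (s e) ≠ col (t e)) (hJ : IsMinJoin s t A J)
    (hv : ∀ J', IsMinJoin s t A J' → bdry s t J' = bdry s t J →
      #{e ∈ J' | s e = v ∨ t e = v} = 1)
    (he : e ∈ J) (hev : s e = v ∨ t e = v) (C : Finset E) (hC : C ⊆ A)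
    (hCv : ∀ f ∈ C, ¬ (s f = v ∨ t f = v)) (hN : ∀ z, bdry s t C z ≠ 0 → Nbr s t A v z) :
    0 ≤ wt J C := by
  induction C using Finset.strongInduction with
  | H C ih =>
    by_cases hb : bdry s t C = 0
    · exact hJ.wt_nonneg hC hb
    obtain ⟨z, hz⟩ := Function.ne_iff.1 hb
    obtain ⟨z', hzz, hz', R, hR, hRb⟩ := exists_joined_of_bdry_ne_zero hz
    have hRne : R.Nonempty := by
      by_contra! h
      rw [h, bdry_empty] at hRb
      have := congrFun hRb z
      simp [hzz.symm] at this
    rw [wt_sdiff hR]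
    refine add_nonneg (ih (C \ R) (Finset.sdiff_ssubset hR hRne) (Finset.sdiff_subset.trans hC)
      (fun f hf => hCv f (Finset.sdiff_subset hf)) fun w hw => ?_)
      (wt_nonneg_of_joined_nbr hcol hJ hv he hev (hR.trans hC) (fun f hf => hCv f (hR hf))
        hzz.symm (hN z hz) (hN z' hz') hRb)
    by_cases hwz : w = z
    · exact hwz ▸ hN z hz
    by_cases hwz' : w = z'
    · exact hwz' ▸ hN z' hz'
    refine hN w ?_
    rw [bdry_sdiff s t hR, hRb] at hw
    simpa [hwz, hwz'] using hw

open scoped Classical in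
/-- The contraction of the star of `v`: it sends `v` and its neighbours to `u₀`, and fixes all other
vertices. The vertex type stays the same, so `u₀` should be a neighbour of `v`. -/
noncomputable def contract (s t : E → V) (A : Finset E) (v u₀ : V) (w : V) : V :=
  if w = v ∨ Nbr s t A v w then u₀ else w

theorem isMinJoin_contract (hcol : ∀ e ∈ A, col (s e) ≠ col (t e)) (hJ : IsMinJoin s t A J)
    (hv : ∀ J', IsMinJoin s t A J' → bdry s t J' = bdry s t J →
      #{e ∈ J' | s e = v ∨ t e = v} = 1)
    (he : e ∈ J) (hev : s e = v ∨ t e = v) {u₀ : V} (hu : Nbr s t A v u₀) :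
    IsMinJoin (contract s t A v u₀ ∘ s) (contract s t A v u₀ ∘ t)
      {f ∈ A | ¬ (s f = v ∨ t f = v)} (J.erase e) := by
  have hJv : ∀ f ∈ J, (s f = v ∨ t f = v) → f = e := fun f hf hfv =>
    Finset.card_le_one.1 (hv J hJ rfl).le f (by simp [hf, hfv]) e (by simp [he, hev])
  have hsub : J.erase e ⊆ {f ∈ A | ¬ (s f = v ∨ t f = v)} := fun f hf => by
    rw [Finset.mem_erase] at hf
    exact Finset.mem_filter.2 ⟨hJ.1 hf.2, fun h => hf.1 (hJv f hf.2 h)⟩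
  refine ⟨hsub, fun K hK hKb => ?_⟩
  have hCsub : J.erase e ∆ K ⊆ {f ∈ A | ¬ (s f = v ∨ t f = v)} :=
    symmDiff_le_sup.trans (Finset.union_subset hsub hK)
  have hCv : ∀ f ∈ J.erase e ∆ K, ¬ (s f = v ∨ t f = v) := fun f hf =>
    (Finset.mem_filter.1 (hCsub hf)).2
  have heC : e ∉ J.erase e ∆ K := fun h => hCv e h hev
  have hw : wt (J.erase e) (J.erase e ∆ K) = wt J (J.erase e ∆ K) := by
    refine Finset.sum_congr rfl fun f hf => ?_
    have : f ≠ e := fun h => heC (h ▸ hf)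
    simp [this]
  have h0 : 0 ≤ wt J (J.erase e ∆ K) := by
    refine wt_nonneg_of_bdry_nbr hcol hJ hv he hev _ (hCsub.trans (Finset.filter_subset _ _)) hCv
      fun w hw => ?_
    by_contra hN
    apply hw
    by_cases hwv : w = v
    · exact bdry_eq_zero_of_forall s t fun f hf => not_or.1 (hwv ▸ hCv f hf)
    have hφ : ∀ x, contract s t A v u₀ x = w ↔ x = w := by
      intro x
      rw [contract]
      split_ifs with h
      · constructor
        · rintro rfl
          exact absurd hu hN
        · rintro rfl
          exact absurd h (not_or.2 ⟨hwv, hN⟩)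
      · rfl
    have h1 : bdry (contract s t A v u₀ ∘ s) (contract s t A v u₀ ∘ t) (J.erase e ∆ K) w = 0 := by
      rw [bdry_symmDiff, hKb, add_self_fun]
      rfl
    rw [← h1, bdry_apply, bdry_apply]
    simp only [Function.comp_apply, hφ]
  have h1 := card_symmDiff_eq (J.erase e) (J.erase e ∆ K)
  rw [symmDiff_symmDiff_cancel_left, hw] at h1
  omega

/-- All neighbours of `v` have the same colour, so the old colouring is still proper on the edges
that avoid `v`. -/
theorem contract_col (hcol : ∀ e ∈ A, col (s e) ≠ col (t e)) {u₀ : V} (hu : Nbr s t A v u₀)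
    {w : V} (hw : w ≠ v) : col (contract s t A v u₀ w) = col w := by
  have key : ∀ z, Nbr s t A v z → col z = col v + 1 := by
    have hz2 : ∀ a b : ZMod 2, a ≠ b → b = a + 1 := by decide
    rintro z ⟨f, hf, (⟨rfl, rfl⟩ | ⟨rfl, rfl⟩)⟩
    · exact hz2 _ _ (hcol f hf)
    · exact hz2 _ _ (hcol f hf).symm
  rw [contract]
  split_ifs with h
  · rw [key _ hu, key _ (h.resolve_left hw)]
  · rfl

end Contraction

/-- The colouring `col` makes the multigraph bipartite. -/
theorem three_mul_card_le_of_bipartite (col : V → ZMod 2)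
    (hcol : ∀ e ∈ A, col (s e) ≠ col (t e)) (hJ : IsMinJoin s t A J)
    (hcut : ∀ g : V → ZMod 2, Odd #{e ∈ J | g (s e) ≠ g (t e)} →
      3 ≤ #{e ∈ A | g (s e) ≠ g (t e)}) : 3 * #J ≤ #A := by
  induction hn : #J generalizing s t A J with
  | zero => simp
  | succ n ih =>
    obtain ⟨v, hv⟩ := exists_vertex_card_eq_one (fun e he h => hcol e he (by rw [h])) hJ
      (Finset.card_pos.1 (by omega))
    have hone := hv J hJ rfl
    obtain ⟨e, hemem⟩ := Finset.card_eq_one.1 hone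
    have he' : e ∈ {e ∈ J | s e = v ∨ t e = v} := by rw [hemem]; simp
    rw [Finset.mem_filter] at he'
    obtain ⟨he, hev⟩ := he'
    obtain ⟨u₀, hu⟩ : ∃ u₀, Nbr s t A v u₀ := by
      rcases hev with h | h
      · exact ⟨_, e, hJ.1 he, .inl ⟨h, rfl⟩⟩
      · exact ⟨_, e, hJ.1 he, .inr ⟨rfl, h⟩⟩
    -- in a bipartite graph, the star of `v` is the cut around `v`
    have hstar : ∀ S ⊆ A, {f ∈ S | (Pi.single v 1 : V → ZMod 2) (s f) ≠
        (Pi.single v 1 : V → ZMod 2) (t f)} = {f ∈ S | s f = v ∨ t f = v} := by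
      intro S hS
      refine Finset.filter_congr fun f hf => ?_
      have hl : s f ≠ t f := fun h => hcol f (hS hf) (by rw [h])
      by_cases h1 : s f = v
      · have h2 : t f ≠ v := fun h => hl (h1.trans h.symm)
        simp [h1, h2]
      · by_cases h2 : t f = v <;> simp [h1, h2]
    have h3 := hcut (Pi.single v 1) (by rw [hstar J hJ.1, hone]; exact odd_one)
    rw [hstar A subset_rfl] at h3
    have hsplit := Finset.card_filter_add_card_filter_not (s := A) (fun f => s f = v ∨ t f = v)
    have hJ' := isMinJoin_contract hcol hJ hv he hev hu
    have := ih (s := contract s t A v u₀ ∘ s) (t := contract s t A v u₀ ∘ t) ?_ hJ' ?_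
      (by rw [Finset.card_erase_of_mem he]; omega)
    · omega
    · intro f hf
      obtain ⟨hfA, hfv⟩ := Finset.mem_filter.1 hf
      rw [not_or] at hfv
      simp only [Function.comp_apply]
      rw [contract_col hcol hu hfv.1, contract_col hcol hu hfv.2]
      exact hcol f hfA
    · intro g hg
      have hloop : ∀ f ∈ A, (s f = v ∨ t f = v) →
          contract s t A v u₀ (s f) = contract s t A v u₀ (t f) := by
        intro f hf hfv
        have hboth : ∀ w, (w = s f ∨ w = t f) → w = v ∨ Nbr s t A v w := by
          rintro w (rfl | rfl)
          · exact hfv.imp id fun h => ⟨f, hf, .inr ⟨rfl, h⟩⟩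
          · exact hfv.symm.imp id fun h => ⟨f, hf, .inl ⟨h, rfl⟩⟩
        rw [contract, contract, if_pos (hboth _ (.inl rfl)), if_pos (hboth _ (.inr rfl))]
      have heq : ∀ f ∈ A, (¬ (s f = v ∨ t f = v) ∧
          (g ∘ contract s t A v u₀) (s f) ≠ (g ∘ contract s t A v u₀) (t f)) ↔
          (g ∘ contract s t A v u₀) (s f) ≠ (g ∘ contract s t A v u₀) (t f) := by
        intro f hf
        refine and_iff_right_of_imp fun h hfv => h ?_
        simp only [Function.comp_apply, hloop f hf hfv]
      have h := hcut (g ∘ contract s t A v u₀) ?_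
      · refine h.trans (Finset.card_le_card fun f hf => ?_)
        rw [Finset.mem_filter] at hf ⊢
        exact ⟨Finset.mem_filter.2 ⟨hf.1, ((heq f hf.1).2 hf.2).1⟩, hf.2⟩
      · convert hg using 2
        ext f
        simp only [Finset.mem_filter, Finset.mem_erase]
        refine ⟨fun hf => ⟨⟨?_, hf.1⟩, hf.2⟩, fun hf => ⟨hf.1.2, hf.2⟩⟩
        rintro rfl
        exact ((heq f (hJ.1 hf.1)).2 hf.2).1 hev

end EdgeChain

/-! ### Subdivision, and even subgraphs of bridgeless multigraphs -/

namespace EdgeChain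

open Finset
open scoped symmDiff

variable {V E : Type*} [Fintype V] [DecidableEq V] [Fintype E] [DecidableEq E]

section Subdivision

variable (s t : E → V)

/-- The end in `V` of the half `x` of an edge, in the multigraph where each edge `e` is subdivided by
the new vertex `e`; the half `(e, true)` is at `t e`, and `(e, false)` at `s e`. -/
def subdivLeft (x : E × Bool) : V ⊕ E := .inl (if x.2 then t x.1 else s x.1)

/-- The end of the half `x` of an edge at the vertex that subdivides this edge. -/
def subdivRight (V : Type*) {E : Type*} (x : E × Bool) : V ⊕ E := .inr x.1

theorem bdry_subdiv_inl (K : Finset E) (v : V) :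
    bdry (subdivLeft s t) (subdivRight V) (K ×ˢ univ) (.inl v) = bdry s t K v := by
  rw [bdry_apply, bdry_apply, Finset.sum_product]
  refine Finset.sum_congr rfl fun e _ => ?_
  rw [Fintype.sum_bool]
  simp [subdivLeft, subdivRight, add_comm]

theorem bdry_subdiv_inr (K : Finset (E × Bool)) (e : E) :
    bdry (subdivLeft s t) (subdivRight V) K (.inr e) =
      (if (e, true) ∈ K then 1 else 0) + (if (e, false) ∈ K then 1 else 0) := by
  have h : ∀ x : E × Bool, ((if subdivLeft s t x = .inr e then (1 : ZMod 2) else 0) +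
      (if subdivRight V x = .inr e then 1 else 0)) =
      (if x = (e, true) then 1 else 0) + (if x = (e, false) then 1 else 0) := by
    rintro ⟨f, b⟩
    cases b <;> simp [subdivLeft, subdivRight]
  rw [bdry_apply, Finset.sum_congr rfl fun x _ => h x, Finset.sum_add_distrib]
  simp

theorem exists_eq_product_of_bdry_subdiv {K : Finset (E × Bool)}
    (h : ∀ e, bdry (subdivLeft s t) (subdivRight V) K (.inr e) = 0) :
    K = K.image Prod.fst ×ˢ univ := by
  have key : ∀ e, (e, true) ∈ K ↔ (e, false) ∈ K := by
    intro e
    have := h e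
    rw [bdry_subdiv_inr] at this
    by_cases h1 : (e, true) ∈ K <;> by_cases h2 : (e, false) ∈ K <;> simp_all
  ext ⟨e, b⟩
  cases b <;> simp [key]

end Subdivision

variable {s t : E → V} {A J : Finset E}

theorem IsMinJoin.subdiv (hJ : IsMinJoin s t A J) :
    IsMinJoin (subdivLeft s t) (subdivRight V) (A ×ˢ univ) (J ×ˢ univ) := by
  refine ⟨Finset.product_subset_product_left hJ.1, fun K hK hb => ?_⟩
  have hprod := exists_eq_product_of_bdry_subdiv s t (K := K) fun e => by
    rw [hb, bdry_subdiv_inr]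
    by_cases h : e ∈ J <;> simp [h]
    exact CharTwo.add_self_eq_zero _
  have hK' : K.image Prod.fst ⊆ A := fun e he => by
    obtain ⟨x, hx, rfl⟩ := Finset.mem_image.1 he
    exact (Finset.mem_product.1 (hK hx)).1
  have := hJ.2 _ hK' (by
    ext v
    rw [← bdry_subdiv_inl, ← hprod, hb, bdry_subdiv_inl])
  rw [hprod, Finset.card_product, Finset.card_product]
  exact Nat.mul_le_mul_right _ this

theorem IsMinJoin.three_mul_card_le (hJ : IsMinJoin s t A J)
    (hcut : ∀ g : V → ZMod 2, Odd #{e ∈ J | g (s e) ≠ g (t e)} →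
      3 ≤ #{e ∈ A | g (s e) ≠ g (t e)}) : 3 * #J ≤ #A := by
  have h := three_mul_card_le_of_bipartite (Sum.elim 0 1)
    (by simp [subdivLeft, subdivRight]) hJ.subdiv ?_
  · rw [Finset.card_product, Finset.card_product] at h
    simp only [Finset.card_univ, Fintype.card_bool] at h
    omega
  · intro g hg
    have hodd : Odd #{e ∈ J | (g ∘ Sum.inl) (s e) ≠ (g ∘ Sum.inl) (t e)} := by
      rw [← ZMod.natCast_eq_one_iff_odd] at hg ⊢
      rw [← hg, card_cut, card_cut, sum_mul_bdry, sum_mul_bdry, Finset.sum_product]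
      refine Finset.sum_congr rfl fun e _ => ?_
      simp only [Fintype.sum_bool, subdivLeft, subdivRight, Function.comp_apply, if_true,
        Bool.false_eq_true, if_false]
      generalize g (Sum.inl (s e)) = a
      generalize g (Sum.inl (t e)) = b
      generalize g (Sum.inr e) = c
      revert a b c
      decide
    refine (hcut _ hodd).trans (Finset.card_le_card_of_surjOn Prod.fst fun e he => ?_)
    obtain ⟨heA, he⟩ := Finset.mem_filter.1 (Finset.mem_coe.1 he)
    have hmem : ∀ b, g (subdivLeft s t (e, b)) ≠ g (subdivRight V (e, b)) →
        (e, b) ∈ {x ∈ A ×ˢ (univ : Finset Bool) | g (subdivLeft s t x) ≠ g (subdivRight V x)} := fun b hb =>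
      Finset.mem_filter.2 ⟨Finset.mem_product.2 ⟨heA, Finset.mem_univ _⟩, hb⟩
    by_cases h1 : g (Sum.inl (s e)) = g (Sum.inr e)
    · exact ⟨(e, true), hmem _ fun h => he (h1.trans h.symm), rfl⟩
    · exact ⟨(e, false), hmem _ h1, rfl⟩

/-- A bridgeless multigraph has an even set of at least two thirds of its edges. -/
theorem exists_even_subset (hA : ∀ g : V → ZMod 2, #{e ∈ A | g (s e) ≠ g (t e)} ≠ 1) :
    ∃ F ⊆ A, bdry s t F = 0 ∧ 2 * #A ≤ 3 * #F := by
  obtain ⟨F, hF, hmax⟩ := Finset.exists_max_image {F ∈ A.powerset | bdry s t F = 0} card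
    ⟨∅, by simp⟩
  rw [Finset.mem_filter, Finset.mem_powerset] at hF
  obtain ⟨hFA, hF0⟩ := hF
  have hJ : IsMinJoin s t A (A \ F) := by
    refine ⟨Finset.sdiff_subset, fun K hK hKb => ?_⟩
    have h := hmax (A \ K) (by
      simp only [Finset.mem_filter, Finset.mem_powerset, Finset.sdiff_subset, true_and]
      rw [bdry_sdiff s t hK, hKb, bdry_sdiff s t hFA, hF0, add_zero, add_self_fun])
    have h1 := Finset.card_sdiff_add_card_eq_card hK
    have h2 := Finset.card_sdiff_add_card_eq_card hFA
    omega
  refine ⟨F, hFA, hF0, ?_⟩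
  have h3 := hJ.three_mul_card_le fun g hg => ?_
  · have h2 := Finset.card_sdiff_add_card_eq_card hFA
    omega
  · have hne := hA g
    have hFe := even_card_cut s t hF0 g
    have hsum : #{e ∈ A | g (s e) ≠ g (t e)} =
        #{e ∈ A \ F | g (s e) ≠ g (t e)} + #{e ∈ F | g (s e) ≠ g (t e)} := by
      rw [← Finset.card_union_of_disjoint (Finset.disjoint_filter_filter
        Finset.sdiff_disjoint), ← Finset.filter_union, Finset.sdiff_union_of_subset hFA]
    obtain ⟨a, ha⟩ := hg
    obtain ⟨b, hb⟩ := hFe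
    omega

end EdgeChain

/-! ### Cubic multigraphs with cut-edges -/

namespace EdgeChain

open Finset
open scoped symmDiff

section Forest

variable {V E : Type*} [Fintype V] [DecidableEq V] [DecidableEq E] {s t : E → V}

/-- A nonempty forest has more vertices than edges. -/
theorem card_lt_card_of_acyclic {B : Finset E} (hB : ∀ S ⊆ B, bdry s t S = 0 → S = ∅)
    {W : Finset V} (hW : ∀ e ∈ B, s e ∈ W ∧ t e ∈ W) (hne : W.Nonempty) : #B < #W := by
  obtain ⟨w₀, hw₀⟩ := hne
  let φ : B.powerset → (W.erase w₀ → ZMod 2) := fun S w => bdry s t S.1 w.1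
  have hφ : Function.Injective φ := by
    intro S S' h
    have hsub : ∀ S : B.powerset, S.1 ⊆ B := fun S => Finset.mem_powerset.1 S.2
    have hD : S.1 ∆ S'.1 ⊆ B := symmDiff_le_sup.trans (Finset.union_subset (hsub S) (hsub S'))
    have h0 : ∀ w, w ≠ w₀ → bdry s t (S.1 ∆ S'.1) w = 0 := by
      intro w hw
      by_cases hwW : w ∈ W
      · have := congrFun h ⟨w, Finset.mem_erase.2 ⟨hw, hwW⟩⟩
        simp only [φ] at this
        rw [bdry_symmDiff, Pi.add_apply, this]
        exact CharTwo.add_self_eq_zero _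
      · exact bdry_eq_zero_of_forall s t fun e he =>
          ⟨fun h => hwW (h ▸ (hW e (hD he)).1), fun h => hwW (h ▸ (hW e (hD he)).2)⟩
    have h1 : bdry s t (S.1 ∆ S'.1) w₀ = 0 := by
      have hsum := sum_mul_bdry s t (fun _ => 1) (S.1 ∆ S'.1)
      rw [Finset.sum_eq_single w₀ (fun w _ hw => by rw [h0 w hw, mul_zero]) (by simp),
        Finset.sum_eq_zero fun _ _ => CharTwo.add_self_eq_zero _, one_mul] at hsum
      exact hsum
    have h2 : S.1 ∆ S'.1 = ∅ := hB _ hD (by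
      ext w
      by_cases hw : w = w₀
      · rw [hw, h1]; rfl
      · rw [h0 w hw]; rfl)
    exact Subtype.ext (symmDiff_eq_bot.1 h2)
  have hcard := Fintype.card_le_of_injective φ hφ
  rw [Fintype.card_coe, Finset.card_powerset, Fintype.card_fun, ZMod.card, Fintype.card_coe,
    Finset.card_erase_of_mem hw₀] at hcard
  have := (Nat.pow_le_pow_iff_right (by norm_num)).1 hcard
  have : 0 < #W := Finset.card_pos.2 ⟨w₀, hw₀⟩
  omega

end Forest

variable {V E : Type*} [Fintype V] [DecidableEq V] [Fintype E] [DecidableEq E] {s t : E → V}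
  {B : Finset E}

/-- A cycle crosses no cut in exactly one edge, so it contains no bridge. -/
theorem exists_cycle_avoiding_bridges
    (hB : ∀ b ∈ B, ∃ g : V → ZMod 2, ∀ e, g (s e) ≠ g (t e) ↔ e = b) {e : E}
    (hj : JoinedBy s t (univ.erase e) (s e) (t e)) :
    ∃ C ⊆ Bᶜ, bdry s t C = 0 ∧ e ∈ C := by
  obtain ⟨R, hR, hRb⟩ := hj
  have heR : e ∉ R := fun h => by simpa using hR h
  have hC : bdry s t (insert e R) = 0 := by rw [bdry_insert s t heR, hRb, add_self_fun]
  refine ⟨insert e R, fun b hb => ?_, hC, Finset.mem_insert_self _ _⟩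
  rw [Finset.mem_compl]
  intro hbB
  obtain ⟨g, hg⟩ := hB b hbB
  have := even_card_cut s t hC g
  simp only [hg] at this
  rw [Finset.filter_eq', if_pos hb] at this
  simp at this

/-- Once the bridges are deleted, no new bridge appears. -/
theorem card_cut_compl_bridges_ne_one
    (hB : ∀ b ∈ B, ∃ g : V → ZMod 2, ∀ e, g (s e) ≠ g (t e) ↔ e = b)
    (hB' : ∀ e ∉ B, JoinedBy s t (univ.erase e) (s e) (t e)) (g : V → ZMod 2) :
    #{e ∈ Bᶜ | g (s e) ≠ g (t e)} ≠ 1 := by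
  intro h
  obtain ⟨f, hf⟩ := Finset.card_eq_one.1 h
  have hmem : ∀ e, e ∈ Bᶜ → g (s e) ≠ g (t e) → e = f := fun e he heg => by
    rw [← Finset.mem_singleton, ← hf]
    exact Finset.mem_filter.2 ⟨he, heg⟩
  have hfm : f ∈ {e ∈ Bᶜ | g (s e) ≠ g (t e)} := by rw [hf]; simp
  obtain ⟨hfB, hfg⟩ := Finset.mem_filter.1 hfm
  rw [Finset.mem_compl] at hfB
  obtain ⟨C, hC, hCb, hfC⟩ := exists_cycle_avoiding_bridges hB (hB' f hfB)
  have heven := even_card_cut s t hCb g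
  have : {e ∈ C | g (s e) ≠ g (t e)} = {f} := by
    ext e
    rw [Finset.mem_filter, Finset.mem_singleton]
    exact ⟨fun h => hmem e (hC h.1) h.2, fun h => h ▸ ⟨hfC, hfg⟩⟩
  rw [this] at heven
  simp at heven

/-- The components of the multigraph with edge set `A`, as an equivalence relation on vertices. -/
def joinedSetoid (s t : E → V) (A : Finset E) : Setoid V where
  r := JoinedBy s t A
  iseqv := ⟨JoinedBy.refl A, JoinedBy.symm, JoinedBy.trans⟩

theorem JoinedBy.eq_of_forall {A : Finset E} {x y : V} (h : JoinedBy s t A x y) {g : V → ZMod 2}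
    (hg : ∀ e ∈ A, g (s e) = g (t e)) : g x = g y := by
  obtain ⟨R, hR, hRb⟩ := h
  have hsum := sum_mul_bdry s t g R
  rw [hRb, Finset.sum_eq_zero (s := R) fun e he => by
    rw [hg e (hR he)]; exact CharTwo.add_self_eq_zero _] at hsum
  simp only [Pi.add_apply, mul_add, Finset.sum_add_distrib, Pi.single_apply, mul_ite, mul_one,
    mul_zero, Finset.sum_ite_eq', Finset.mem_univ, if_true] at hsum
  exact CharTwo.add_eq_zero.1 hsum

/-- `B` is the set of bridges. In a cubic multigraph, `#F` is the number of vertices that an even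
set `F` covers. The natural subtraction makes the error term `0` when there are no bridges. -/
theorem exists_even_subset_of_cubic
    (hdeg : ∀ v, ∑ e, ((if s e = v then 1 else 0) + (if t e = v then 1 else 0)) = 3)
    (hB : ∀ b ∈ B, ∃ g : V → ZMod 2, ∀ e, g (s e) ≠ g (t e) ↔ e = b)
    (hB' : ∀ e ∉ B, JoinedBy s t (univ.erase e) (s e) (t e)) :
    ∃ F, bdry s t F = 0 ∧ 2 * Fintype.card V ≤ 2 * #F + (#B - 1) := by
  classical
  let r := joinedSetoid s t Bᶜ
  let cls : V → Quotient r := Quotient.mk r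
  have hcls : ∀ e ∈ Bᶜ, cls (s e) = cls (t e) := fun e he =>
    Quotient.sound (s := r) (JoinedBy.of_mem he)
  let part : Quotient r → Finset E := fun q => {e ∈ Bᶜ | cls (s e) = q}
  have hpart : ∀ q, ∃ F ⊆ part q, bdry s t F = 0 ∧ 2 * #(part q) ≤ 3 * #F := by
    intro q
    refine exists_even_subset fun g h1 => ?_
    -- flatten `g` outside the class `q`
    refine card_cut_compl_bridges_ne_one hB hB' (fun v => if cls v = q then g v else 0) ?_
    rw [← h1, Finset.filter_filter]
    congr 1
    refine Finset.filter_congr fun e he => ?_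
    rw [← hcls e he]
    by_cases h : cls (s e) = q <;> simp [h]
  choose F hF hF0 hFc using hpart
  -- the number of ends of bridges in a class
  let k : Quotient r → ℕ := fun q =>
    ∑ e ∈ B, ((if cls (s e) = q then 1 else 0) + (if cls (t e) = q then 1 else 0))
  have hdisj : ∀ q q', q ≠ q' → Disjoint (F q) (F q') := fun q q' hqq =>
    Finset.disjoint_left.2 fun e he he' => hqq
      ((Finset.mem_filter.1 (hF q he)).2.symm.trans (Finset.mem_filter.1 (hF q' he')).2)
  -- the degree sum over a class
  have hcount : ∀ q, 3 * #{v | cls v = q} = 2 * #(part q) + k q := by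
    intro q
    have h1 : 3 * #{v | cls v = q} =
        ∑ e, ((if cls (s e) = q then 1 else 0) + (if cls (t e) = q then 1 else 0)) := by
      rw [mul_comm, ← smul_eq_mul, ← Finset.sum_const, ← Finset.sum_congr rfl fun v _ => hdeg v,
        Finset.sum_comm]
      refine Finset.sum_congr rfl fun e _ => ?_
      rw [Finset.sum_add_distrib, Finset.sum_ite_eq, Finset.sum_ite_eq]
      simp
    rw [h1, ← Finset.sum_compl_add_sum B]
    congr 1
    rw [Finset.sum_congr rfl fun e he => by rw [← hcls e he], Finset.sum_add_distrib,
      ← two_mul, ← Finset.card_filter]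
  have hksum : ∑ q, k q = 2 * #B := by
    simp only [k]
    rw [Finset.sum_comm]
    simp [Finset.sum_add_distrib, mul_comm]
  have hVsum : ∑ q, #{v | cls v = q} = Fintype.card V :=
    (Finset.card_eq_sum_card_fiberwise (f := cls) (s := univ) (t := univ) (by simp)).symm
  -- the cut-edges form a forest on the classes
  have hforest : #B ≠ 0 → #B < #{q | k q ≠ 0} := by
    intro hne
    have hW : ∀ e ∈ B, (cls ∘ s) e ∈ ({q | k q ≠ 0} : Finset _) ∧
        (cls ∘ t) e ∈ ({q | k q ≠ 0} : Finset _) := by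
      intro e he
      simp only [Finset.mem_filter, Finset.mem_univ, true_and, Function.comp_apply]
      constructor <;> intro h0 <;> have := Finset.sum_eq_zero_iff.1 h0 e he <;> simp at this
    refine card_lt_card_of_acyclic (s := cls ∘ s) (t := cls ∘ t) (fun S hS hSb => ?_) hW ?_
    · by_contra! hSne
      obtain ⟨b, hb⟩ := hSne
      obtain ⟨g, hg⟩ := hB b (hS hb)
      -- the cut of the bridge `b` is constant on classes
      have hlift : ∀ x y, r x y → g x = g y := fun x y hxy =>
        JoinedBy.eq_of_forall hxy fun e he => by
          by_contra hne
          exact Finset.mem_compl.1 he (((hg e).1 hne).symm ▸ hS hb)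
      have heven := even_card_cut (cls ∘ s) (cls ∘ t) hSb (Quotient.lift g hlift)
      simp only [Function.comp_apply, cls, Quotient.lift_mk, hg] at heven
      rw [Finset.filter_eq', if_pos hb] at heven
      simp at heven
    · obtain ⟨e, he⟩ := Finset.card_ne_zero.1 hne
      exact ⟨_, (hW e he).1⟩
  refine ⟨univ.biUnion F, ?_, ?_⟩
  · rw [bdry, Finset.sum_biUnion fun q _ q' _ hqq => hdisj q q' hqq]
    exact Finset.sum_eq_zero fun q _ => hF0 q
  · rw [Finset.card_biUnion fun q _ q' _ hqq => hdisj q q' hqq, ← hVsum, Finset.mul_sum,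
      Finset.mul_sum]
    have hle : ∀ q, 2 * #{v | cls v = q} ≤ 2 * #(F q) + (k q - 1) := by
      intro q
      have h1 := hcount q
      have h2 := hFc q
      omega
    have h1 := Finset.sum_le_sum fun q (_ : q ∈ univ) => hle q
    rw [Finset.sum_add_distrib] at h1
    have h2 : ∑ q, (k q - 1) + #{q | k q ≠ 0} = 2 * #B := by
      rw [← hksum, Finset.card_filter, ← Finset.sum_add_distrib]
      refine Finset.sum_congr rfl fun q _ => ?_
      split_ifs <;> omega
    by_cases h0 : #B = 0
    · omega
    · have := hforest h0
      omega

end EdgeChain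

/-! ### From multigraphs to chains: the lower bound -/

namespace Graph

open Finset
open scoped symmDiff
open EdgeChain

variable {α β : Type*} {G H : Graph α β}

/-- An orientation of all edges. -/
theorem exists_ends (G : Graph α β) :
    ∃ s t : G.edgeSet → G.vertexSet, ∀ e : G.edgeSet, G.IsLink e (s e) (t e) := by
  have h : ∀ e : G.edgeSet, ∃ x y : G.vertexSet, G.IsLink e x y := fun e => by
    obtain ⟨x, y, hxy⟩ := exists_isLink_of_mem_edgeSet e.2
    exact ⟨⟨x, hxy.left_mem⟩, ⟨y, hxy.right_mem⟩, hxy⟩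
  choose s t hst using h
  exact ⟨s, t, hst⟩

section Ends

variable [DecidableEq G.vertexSet] {s t : G.edgeSet → G.vertexSet}

theorem degree_eq_sum (hst : ∀ e : G.edgeSet, G.IsLink e (s e) (t e))
    (hH : H ≤ G) {F : Finset G.edgeSet}
    (hF : ∀ e : G.edgeSet, e ∈ F ↔ e.1 ∈ H.edgeSet) (x : G.vertexSet) :
    H.degree x = ∑ e ∈ F, ((if s e = x then 1 else 0) + (if t e = x then 1 else 0)) := by
  have hG : ∀ {e y}, H.IsLink e x y → ∃ e' : G.edgeSet, e'.1 = e ∧ e' ∈ F ∧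
      ((x = s e' ∧ y = (t e').1) ∨ (x = t e' ∧ y = (s e').1)) := by
    intro e y h
    refine ⟨⟨e, (h.mono hH).edge_mem⟩, rfl, (hF _).2 h.edge_mem, ?_⟩
    have := (h.mono hH).eq_and_eq_or_eq_and_eq (hst ⟨e, (h.mono hH).edge_mem⟩)
    simpa only [Subtype.ext_iff] using this
  have hlink : ∀ e ∈ F, H.IsLink e (s e) (t e) := fun e he =>
    (IsSubgraph.isLink_iff hH ((hF e).1 he)).2 (hst e)
  have h1 : H.incidenceSet x = Subtype.val '' (↑{e ∈ F | s e = x ∨ t e = x} : Set G.edgeSet) := by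
    ext e
    simp only [mem_incidenceSet, Set.mem_image, Finset.mem_coe, Finset.mem_filter]
    constructor
    · rintro ⟨y, h⟩
      obtain ⟨e', rfl, he', h⟩ := hG h
      exact ⟨e', ⟨he', h.imp (fun h => h.1.symm) fun h => h.1.symm⟩, rfl⟩
    · rintro ⟨e', ⟨he', rfl | rfl⟩, rfl⟩
      · exact ⟨_, hlink e' he'⟩
      · exact ⟨_, (hlink e' he').symm⟩
  have h2 : H.loopSet x = Subtype.val '' (↑{e ∈ F | s e = x ∧ t e = x} : Set G.edgeSet) := by
    ext e
    simp only [mem_loopSet, Set.mem_image, Finset.mem_coe, Finset.mem_filter]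
    constructor
    · intro h
      obtain ⟨e', rfl, he', h⟩ := hG h
      refine ⟨e', ⟨he', ?_⟩, rfl⟩
      rcases h with ⟨h, h'⟩ | ⟨h, h'⟩
      · exact ⟨h.symm, Subtype.ext h'.symm⟩
      · exact ⟨Subtype.ext h'.symm, h.symm⟩
    · rintro ⟨e', ⟨he', hs, ht⟩, rfl⟩
      have := hlink e' he'
      rwa [hs, ht] at this
  rw [degree, h1, h2, Set.ncard_image_of_injective _ Subtype.val_injective,
    Set.ncard_image_of_injective _ Subtype.val_injective, Set.ncard_coe_finset,
    Set.ncard_coe_finset, Finset.card_filter, Finset.card_filter, ← Finset.sum_add_distrib]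
  refine Finset.sum_congr rfl fun e _ => ?_
  by_cases h3 : s e = x <;> by_cases h4 : t e = x <;> simp [h3, h4]

theorem bdry_eq_degree [Fintype G.vertexSet] [DecidableEq G.edgeSet]
    (hst : ∀ e : G.edgeSet, G.IsLink e (s e) (t e)) (hH : H ≤ G) {F : Finset G.edgeSet}
    (hF : ∀ e : G.edgeSet, e ∈ F ↔ e.1 ∈ H.edgeSet) (x : G.vertexSet) :
    bdry s t F x = H.degree x := by
  rw [degree_eq_sum hst hH hF, bdry_apply]
  push_cast
  rfl

/-- A cut-edge is the only edge of some cut: the one around the vertices that can be reached from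
one of its ends without using it. -/
theorem IsCutEdge.exists_cut (hst : ∀ e : G.edgeSet, G.IsLink e (s e) (t e))
    {b : G.edgeSet} (hb : G.IsCutEdge b) :
    ∃ g : G.vertexSet → ZMod 2, ∀ e, g (s e) ≠ g (t e) ↔ e = b := by
  classical
  obtain ⟨x, y, hxy, hn⟩ := hb
  refine ⟨fun v => if Relation.ReflTransGen (G.deleteEdges {b.1}).Adj x v then 0 else 1,
    fun e => ⟨fun h => ?_, ?_⟩⟩
  · by_contra hne
    have hl : (G.deleteEdges {b.1}).IsLink e (s e) (t e) := by
      rw [deleteEdges_isLink]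
      exact ⟨hst e, fun h => hne (Subtype.ext h)⟩
    have : Relation.ReflTransGen (G.deleteEdges {b.1}).Adj x (s e) ↔
        Relation.ReflTransGen (G.deleteEdges {b.1}).Adj x (t e) :=
      ⟨fun h => h.tail hl.adj, fun h => h.tail hl.adj.symm⟩
    exact h (by simp only [this])
  · rintro rfl
    rcases hxy.eq_and_eq_or_eq_and_eq (hst e) with ⟨rfl, rfl⟩ | ⟨rfl, rfl⟩
    · simp [hn, Relation.ReflTransGen.refl]
    · simp [hn, Relation.ReflTransGen.refl]

theorem joined_of_not_isCutEdge [Fintype G.vertexSet] [Fintype G.edgeSet]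
    [DecidableEq G.edgeSet] (hst : ∀ e : G.edgeSet, G.IsLink e (s e) (t e))
    {b : G.edgeSet} (hb : ¬ G.IsCutEdge b) :
    JoinedBy s t (univ.erase b) (s b) (t b) := by
  have h : Relation.ReflTransGen (G.deleteEdges {b.1}).Adj (s b) (t b) := by
    by_contra h
    exact hb ⟨_, _, hst b, h⟩
  have key : ∀ w, Relation.ReflTransGen (G.deleteEdges {b.1}).Adj (s b) w →
      ∃ hw : w ∈ G.vertexSet, JoinedBy s t (univ.erase b) (s b) ⟨w, hw⟩ := by
    intro w hw
    induction hw with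
    | refl => exact ⟨(s b).2, JoinedBy.refl _ _⟩
    | @tail y z _ hyz ih =>
      obtain ⟨hy, hj⟩ := ih
      obtain ⟨e, he⟩ := hyz
      have heG : G.IsLink e y z := he.mono deleteEdges_le
      have hne : e ≠ b.1 := by
        rintro rfl
        have := he.edge_mem
        simp at this
      refine ⟨heG.right_mem, hj.trans ?_⟩
      have hmem : (⟨e, heG.edge_mem⟩ : G.edgeSet) ∈ univ.erase b := by
        simp [Subtype.ext_iff, hne]
      have hj' := JoinedBy.of_mem (s := s) (t := t) hmem
      rcases heG.eq_and_eq_or_eq_and_eq (hst ⟨e, heG.edge_mem⟩) with ⟨h1, h2⟩ | ⟨h1, h2⟩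
      · convert hj'
      · convert hj'.symm
  obtain ⟨_, hj⟩ := key _ h
  exact hj

end Ends

/-- The subgraph formed by a set of edges and their ends. -/
def edgeSubgraph (G : Graph α β) (F : Set β) : Graph α β where
  vertexSet := {x | ∃ e ∈ F, G.Inc e x}
  IsLink e x y := e ∈ F ∧ G.IsLink e x y
  isLink_symm _ _ := ⟨fun _ _ h => ⟨h.1, h.2.symm⟩⟩
  eq_or_eq_of_isLink_of_isLink _ _ _ _ _ h h' := h.2.left_eq_or_eq h'.2
  left_mem_of_isLink e _ _ h := ⟨e, h.1, h.2.inc_left⟩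

theorem edgeSubgraph_le (G : Graph α β) (F : Set β) : G.edgeSubgraph F ≤ G where
  vertexSet_mono := by
    rintro x ⟨e, -, h⟩
    exact h.vertex_mem
  isLink_mono _ _ _ h := h.2

/-- An even degree that is at most `3` and not `0` is `2`. -/
theorem exists_isRegular_two_of_even [Fintype G.vertexSet] [DecidableEq G.vertexSet]
    [Fintype G.edgeSet] (h3 : G.IsRegular 3) {s t : G.edgeSet → G.vertexSet}
    (hst : ∀ e : G.edgeSet, G.IsLink e (s e) (t e)) {F : Finset G.edgeSet} (hF : bdry s t F = 0) :
    ∃ H ≤ G, H.IsRegular 2 ∧ H.vertexSet.ncard = #F := by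
  classical
  let H := G.edgeSubgraph (Subtype.val '' (F : Set G.edgeSet))
  have hH : H ≤ G := edgeSubgraph_le _ _
  have hFH : ∀ e : G.edgeSet, e ∈ F ↔ e.1 ∈ H.edgeSet := by
    intro e
    constructor
    · exact fun he => ⟨s e, t e, ⟨e, he, rfl⟩, hst e⟩
    · rintro ⟨x, y, ⟨e', he', h⟩, -⟩
      exact Subtype.ext h ▸ he'
  have hmem : ∀ x : G.vertexSet, x.1 ∈ H.vertexSet ↔ ∃ e ∈ F, s e = x ∨ t e = x := by
    intro x
    constructor
    · rintro ⟨_, ⟨e, he, rfl⟩, h⟩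
      refine ⟨e, he, ?_⟩
      rcases h.eq_or_eq_of_isLink (hst e) with h | h
      · exact .inl (Subtype.ext h.symm)
      · exact .inr (Subtype.ext h.symm)
    · rintro ⟨e, he, rfl | rfl⟩
      · exact ⟨e, ⟨e, he, rfl⟩, (hst e).inc_left⟩
      · exact ⟨e, ⟨e, he, rfl⟩, (hst e).inc_right⟩
  have hdeg : ∀ x : G.vertexSet, H.degree x = if x.1 ∈ H.vertexSet then 2 else 0 := by
    intro x
    have hsum := degree_eq_sum hst hH hFH x
    split_ifs with hx
    · obtain ⟨e, he, hex⟩ := (hmem x).1 hx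
      have hpos : 0 < H.degree x := by
        rw [hsum]
        refine Finset.sum_pos' (fun _ _ => Nat.zero_le _) ⟨e, he, ?_⟩
        rcases hex with h | h <;> simp [h]
      have hle : H.degree x ≤ 3 := by
        rw [← h3 x x.2, hsum, degree_eq_sum hst le_rfl (F := univ) (by simp)]
        exact Finset.sum_le_sum_of_subset (Finset.subset_univ F)
      have heven : Even (H.degree x) := by
        rw [← ZMod.natCast_eq_zero_iff_even, ← bdry_eq_degree hst hH hFH, hF]
        rfl
      obtain ⟨a, ha⟩ := heven
      omega
    · rw [hsum]
      refine Finset.sum_eq_zero fun e he => ?_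
      have := mt (hmem x).2 hx
      push Not at this
      simp [this e he]
  refine ⟨H, hH, fun x hx => ?_, ?_⟩
  · have := hdeg ⟨x, hH.1 hx⟩
    rwa [if_pos hx] at this
  · have hV : H.vertexSet = Subtype.val '' (↑{x : G.vertexSet | x.1 ∈ H.vertexSet} : Set _) := by
      ext x
      simp only [Set.mem_image]
      exact ⟨fun hx => ⟨⟨x, hH.1 hx⟩, hx, rfl⟩, by rintro ⟨x, hx, rfl⟩; exact hx⟩
    have hc : {x : G.vertexSet | x.1 ∈ H.vertexSet} =
        (↑({x | x.1 ∈ H.vertexSet} : Finset G.vertexSet) : Set _) := by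
      ext; simp
    rw [hV, Set.ncard_image_of_injective _ Subtype.val_injective, hc, Set.ncard_coe_finset]
    have h1 : ∑ x : G.vertexSet, H.degree x = 2 * #{x : G.vertexSet | x.1 ∈ H.vertexSet} := by
      rw [Finset.sum_congr rfl fun x _ => hdeg x, ← Finset.sum_filter, Finset.sum_const,
        smul_eq_mul, mul_comm]
    have h2 : ∑ x : G.vertexSet, H.degree x = 2 * #F := by
      rw [Finset.sum_congr rfl fun x _ => degree_eq_sum hst hH hFH x, Finset.sum_comm]
      simp [Finset.sum_add_distrib, mul_comm]
    omega

theorem two_mul_ncard_le (hV : G.vertexSet.Finite) (hE : G.edgeSet.Finite)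
    (h3 : G.IsRegular 3) :
    2 * G.vertexSet.ncard ≤ 2 * G.maxRegular 2 + (G.cutEdgeSet.ncard - 1) := by
  classical
  have := hV.fintype
  have := hE.fintype
  obtain ⟨s, t, hst⟩ := G.exists_ends
  let B : Finset G.edgeSet := {e | G.IsCutEdge e}
  have hBc : G.cutEdgeSet.ncard = #B := by
    have : G.cutEdgeSet = Subtype.val '' (B : Set G.edgeSet) := by
      ext e
      simp only [cutEdgeSet, Set.mem_image, Finset.mem_coe, B, Finset.mem_filter,
        Finset.mem_univ, true_and]
      constructor
      · intro h
        obtain ⟨x, y, hxy, h'⟩ := h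
        exact ⟨⟨e, hxy.edge_mem⟩, ⟨x, y, hxy, h'⟩, rfl⟩
      · rintro ⟨e, he, rfl⟩
        exact he
    rw [this, Set.ncard_image_of_injective _ Subtype.val_injective, Set.ncard_coe_finset]
  obtain ⟨F, hF, hc⟩ := exists_even_subset_of_cubic (s := s) (t := t) (B := B)
    (fun v => by rw [← degree_eq_sum hst le_rfl (by simp), h3 v v.2])
    (fun b hb => IsCutEdge.exists_cut hst (by simpa [B] using hb))
    (fun e he => joined_of_not_isCutEdge hst (by simpa [B] using he))
  obtain ⟨H, hH, hH2, hHc⟩ := exists_isRegular_two_of_even h3 hst hF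
  have hle := (G.isGreatest_maxRegular 2 hV).2 ⟨H, hH, hH2, hHc⟩
  rw [← Nat.card_eq_fintype_card, Nat.card_coe_set_eq] at hc
  rw [hBc]
  omega

theorem floor_sub_one_div_two (c : ℕ) : ⌊((c : ℚ) - 1) / 2⌋ = ((c : ℤ) - 1) / 2 := by
  have := Rat.floor_intCast_div_natCast ((c : ℤ) - 1) 2
  push_cast at this
  exact this

end Graph

/-! ### Multigraphs that attain the bound -/

namespace Graph

open Finset
open scoped symmDiff
open EdgeChain

variable {α β : Type*} {G H : Graph α β}

theorem isCutEdge_of_cut {e : β} {x y : α} (hxy : G.IsLink e x y) (X : α → Prop)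
    (hX : ∀ f u v, G.IsLink f u v → f ≠ e → X u → X v) (hx : X x) (hy : ¬ X y) :
    G.IsCutEdge e := by
  refine ⟨x, y, hxy, fun h => hy ?_⟩
  clear hxy hy
  induction h with
  | refl => exact hx
  | tail _ huv ih =>
    obtain ⟨f, hf⟩ := huv
    rw [deleteEdges_isLink] at hf
    exact hX f _ _ hf.1 hf.2 ih

/-- A `2`-regular subgraph contains no cut-edge, as it has an even number of edges in every cut. -/
theorem IsCutEdge.notMem_of_isRegular_two (hV : G.vertexSet.Finite) (hE : G.edgeSet.Finite)
    (hH : H ≤ G) (h2 : H.IsRegular 2) {e : β} (he : G.IsCutEdge e) : e ∉ H.edgeSet := by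
  classical
  intro heH
  have := hV.fintype
  have := hE.fintype
  obtain ⟨s, t, hst⟩ := G.exists_ends
  let F : Finset G.edgeSet := {e | e.1 ∈ H.edgeSet}
  have hF : ∀ e : G.edgeSet, e ∈ F ↔ e.1 ∈ H.edgeSet := by simp [F]
  have hb : bdry s t F = 0 := by
    ext x
    rw [bdry_eq_degree hst hH hF]
    by_cases hx : x.1 ∈ H.vertexSet
    · rw [h2 x hx]
      rfl
    · have h1 : H.incidenceSet x = ∅ :=
        Set.eq_empty_of_forall_notMem fun e he => hx (Inc.vertex_mem he)
      have h3 : H.loopSet x = ∅ :=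
        Set.eq_empty_of_forall_notMem fun e he => hx (IsLoopAt.vertex_mem he)
      simp [degree, h1, h3]
  let e' : G.edgeSet := ⟨e, IsSubgraph.edgeSet_mono hH heH⟩
  obtain ⟨g, hg⟩ := IsCutEdge.exists_cut hst (b := e') he
  have heven := even_card_cut s t hb g
  simp only [hg] at heven
  rw [Finset.filter_eq', if_pos ((hF e').2 heH)] at heven
  simp at heven

/-- One end of the edge `e` of `extremal N c`. The edges `3i`, `3i + 1`, `3i + 2` belong to the pair
`2i`, `2i + 1` of vertices. With `p = (c + 1) / 2`, they are as follows.
* If `i < p`: a loop at the leaf `2i`; an edge from the spine vertex `2i + 1` to `2i - 1`, or to the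
  leaf `0` if `i = 0`; and an edge from `2i + 1` to the leaf `2i + 2`, or a loop at `2i + 1`
  if `i + 1 = p`. So these pairs form a caterpillar with `2p - 1` cut-edges.
* If `i = p` and `c = 2p > 0`: a dumbbell, with one more cut-edge `3p + 1`.
* Otherwise: three parallel edges. -/
def extremalLeft (c e : ℕ) : ℕ :=
  if e / 3 < (c + 1) / 2 then
    if e % 3 = 0 then 2 * (e / 3) else 2 * (e / 3) + 1
  else if 0 < c ∧ 2 * (e / 3) = c ∧ e % 3 = 2 then 2 * (e / 3) + 1 else 2 * (e / 3)

/-- The other end of the edge `e` of `extremal N c`; see `extremalLeft`. For `i = 0` the truncated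
`2 * i - 1` is the leaf `0`. -/
def extremalRight (c e : ℕ) : ℕ :=
  if e / 3 < (c + 1) / 2 then
    if e % 3 = 0 then 2 * (e / 3) else if e % 3 = 1 then 2 * (e / 3) - 1 else
      min (2 * (e / 3) + 2) (2 * ((c + 1) / 2) - 1)
  else if 0 < c ∧ 2 * (e / 3) = c ∧ e % 3 = 0 then 2 * (e / 3) else 2 * (e / 3) + 1

theorem extremal_lt {N c e : ℕ} (hc : c < 2 * N) (he : e < 3 * N) :
    extremalLeft c e < 2 * N ∧ extremalRight c e < 2 * N := by
  unfold extremalLeft extremalRight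
  split_ifs <;> omega

/-- A cubic multigraph with `2N` vertices and `c` cut-edges: a caterpillar, at most one dumbbell, and
triple edges. -/
def extremal (N c : ℕ) (hc : c < 2 * N) : Graph ℕ ℕ where
  vertexSet := {v | v < 2 * N}
  edgeSet := {e | e < 3 * N}
  IsLink e x y := e < 3 * N ∧ ((x = extremalLeft c e ∧ y = extremalRight c e) ∨
    (x = extremalRight c e ∧ y = extremalLeft c e))
  isLink_symm e _ := ⟨fun x y h => ⟨h.1, h.2.symm.imp And.symm And.symm⟩⟩
  eq_or_eq_of_isLink_of_isLink e x y v w h h' := by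
    obtain ⟨-, ⟨rfl, rfl⟩ | ⟨rfl, rfl⟩⟩ := h <;> obtain ⟨-, ⟨rfl, rfl⟩ | ⟨rfl, rfl⟩⟩ := h' <;> simp
  edge_mem_iff_exists_isLink e :=
    ⟨fun h => ⟨_, _, h, .inl ⟨rfl, rfl⟩⟩, fun ⟨_, _, h, _⟩ => h⟩
  left_mem_of_isLink e x y h := by
    obtain ⟨he, ⟨rfl, -⟩ | ⟨rfl, -⟩⟩ := h
    · exact (extremal_lt hc he).1
    · exact (extremal_lt hc he).2

variable {N c : ℕ} {hc : c < 2 * N}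

theorem extremal_isLink {e x y : ℕ} : (extremal N c hc).IsLink e x y ↔
    e < 3 * N ∧ ((x = extremalLeft c e ∧ y = extremalRight c e) ∨
      (x = extremalRight c e ∧ y = extremalLeft c e)) := Iff.rfl

theorem extremal_inc {e x : ℕ} : (extremal N c hc).Inc e x ↔
    e < 3 * N ∧ (extremalLeft c e = x ∨ extremalRight c e = x) := by
  constructor
  · rintro ⟨y, he, ⟨rfl, -⟩ | ⟨rfl, -⟩⟩
    · exact ⟨he, .inl rfl⟩
    · exact ⟨he, .inr rfl⟩
  · rintro ⟨he, rfl | rfl⟩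
    · exact ⟨_, he, .inl ⟨rfl, rfl⟩⟩
    · exact ⟨_, he, .inr ⟨rfl, rfl⟩⟩

theorem extremal_degree {x : ℕ} (S T : Finset ℕ)
    (hS : ∀ e, (e < 3 * N ∧ (extremalLeft c e = x ∨ extremalRight c e = x)) ↔ e ∈ S)
    (hT : ∀ e, (e < 3 * N ∧ extremalLeft c e = x ∧ extremalRight c e = x) ↔ e ∈ T) :
    (extremal N c hc).degree x = #S + #T := by
  have h1 : (extremal N c hc).incidenceSet x = S := by
    ext e
    rw [mem_incidenceSet, extremal_inc, hS, Finset.mem_coe]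
  have h2 : (extremal N c hc).loopSet x = T := by
    ext e
    rw [mem_loopSet, Finset.mem_coe, ← hT, IsLoopAt, extremal_isLink]
    grind
  rw [degree, h1, h2, Set.ncard_coe_finset, Set.ncard_coe_finset]

theorem card_triple {a b d : ℕ} (hab : a ≠ b) (had : a ≠ d) (hbd : b ≠ d) :
    #({a, b, d} : Finset ℕ) = 3 :=
  Finset.card_eq_three.2 ⟨a, b, d, hab, had, hbd, rfl⟩

set_option maxHeartbeats 1000000 in
theorem extremal_isRegular : (extremal N c hc).IsRegular 3 := by
  intro x hx
  change x < 2 * N at hx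
  by_cases h1 : x / 2 < (c + 1) / 2
  · by_cases h2 : x % 2 = 0
    · by_cases h3 : x = 0
      · rw [extremal_degree {0, 1} {0}, Finset.card_pair (by omega), Finset.card_singleton]
        all_goals
          intro e
          simp only [Finset.mem_insert, Finset.mem_singleton, extremalLeft, extremalRight]
          split_ifs <;> omega
      · rw [extremal_degree {3 * (x / 2), 3 * (x / 2) - 1} {3 * (x / 2)},
          Finset.card_pair (by omega), Finset.card_singleton]
        all_goals
          intro e
          simp only [Finset.mem_insert, Finset.mem_singleton, extremalLeft, extremalRight]
          split_ifs <;> omega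
    · by_cases h3 : x / 2 + 1 = (c + 1) / 2
      · rw [extremal_degree {3 * (x / 2) + 1, 3 * (x / 2) + 2} {3 * (x / 2) + 2},
          Finset.card_pair (by omega), Finset.card_singleton]
        all_goals
          intro e
          simp only [Finset.mem_insert, Finset.mem_singleton, extremalLeft, extremalRight]
          split_ifs <;> omega
      · rw [extremal_degree {3 * (x / 2) + 1, 3 * (x / 2) + 2, 3 * (x / 2) + 4} ∅,
          card_triple (by omega) (by omega) (by omega), Finset.card_empty]
        all_goals
          intro e
          simp only [Finset.mem_insert, Finset.mem_singleton, extremalLeft, extremalRight,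
            Finset.notMem_empty, iff_false]
          split_ifs <;> omega
  · by_cases h2 : 0 < c ∧ 2 * (x / 2) = c
    · rw [extremal_degree {3 * (x / 2) + x % 2, 3 * (x / 2) + x % 2 + 1}
        {3 * (x / 2) + 2 * (x % 2)}, Finset.card_pair (by omega), Finset.card_singleton]
      all_goals
        intro e
        simp only [Finset.mem_insert, Finset.mem_singleton, extremalLeft, extremalRight]
        split_ifs <;> omega
    · rw [extremal_degree {3 * (x / 2), 3 * (x / 2) + 1, 3 * (x / 2) + 2} ∅,
          card_triple (by omega) (by omega) (by omega), Finset.card_empty]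
      all_goals
        intro e
        simp only [Finset.mem_insert, Finset.mem_singleton, extremalLeft, extremalRight,
          Finset.notMem_empty, iff_false]
        split_ifs <;> omega

theorem extremal_isCutEdge_of_cut {e : ℕ} (he : e < 3 * N) (X : ℕ → Prop)
    (hX : ∀ f, f ≠ e → (X (extremalLeft c f) ↔ X (extremalRight c f)))
    (hl : X (extremalLeft c e)) (hr : ¬ X (extremalRight c e)) :
    (extremal N c hc).IsCutEdge e := by
  refine isCutEdge_of_cut (extremal_isLink.2 ⟨he, .inl ⟨rfl, rfl⟩⟩) X ?_ hl hr
  rintro f u v ⟨-, ⟨rfl, rfl⟩ | ⟨rfl, rfl⟩⟩ hf h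
  · exact (hX f hf).1 h
  · exact (hX f hf).2 h

theorem extremal_not_isCutEdge_of_loop {e : ℕ} (h : extremalLeft c e = extremalRight c e) :
    ¬ (extremal N c hc).IsCutEdge e := by
  rintro ⟨x, y, ⟨-, ⟨rfl, rfl⟩ | ⟨rfl, rfl⟩⟩, hn⟩
  · exact hn (by rw [h])
  · exact hn (by rw [h])

theorem extremal_not_isCutEdge_of_parallel {e f : ℕ} (hf : f < 3 * N) (hfe : f ≠ e)
    (hl : extremalLeft c f = extremalLeft c e) (hr : extremalRight c f = extremalRight c e) :
    ¬ (extremal N c hc).IsCutEdge e := by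
  rintro ⟨x, y, hxy, hn⟩
  refine hn (.single ⟨f, ?_⟩)
  rw [deleteEdges_isLink]
  refine ⟨?_, hfe⟩
  rw [extremal_isLink] at hxy ⊢
  rw [hl, hr]
  exact ⟨hf, hxy.2⟩

theorem extremal_isCutEdge_spine {i : ℕ} (hi : i < (c + 1) / 2) :
    (extremal N c hc).IsCutEdge (3 * i + 1) := by
  refine extremal_isCutEdge_of_cut (by omega)
    (fun v => 2 * i + 1 ≤ v ∧ v < 2 * ((c + 1) / 2)) (fun f hf => ?_) ?_ ?_
  all_goals
    simp only [extremalLeft, extremalRight]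
    split_ifs <;> omega

theorem extremal_isCutEdge_pendant {i : ℕ} (hi : i + 1 < (c + 1) / 2) :
    (extremal N c hc).IsCutEdge (3 * i + 2) := by
  refine extremal_isCutEdge_of_cut (by omega)
    (fun v => v ≠ 2 * i + 2) (fun f hf => ?_) ?_ ?_
  all_goals
    simp only [extremalLeft, extremalRight]
    split_ifs <;> omega

theorem extremal_isCutEdge_dumbbell {i : ℕ} (h0 : 0 < c) (hi : 2 * i = c) :
    (extremal N c hc).IsCutEdge (3 * i + 1) := by
  refine extremal_isCutEdge_of_cut (by omega)
    (fun v => v = 2 * i) (fun f hf => ?_) ?_ ?_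
  all_goals
    simp only [extremalLeft, extremalRight]
    split_ifs <;> omega

theorem extremal_isCutEdge_iff {e : ℕ} : (extremal N c hc).IsCutEdge e ↔
    (e % 3 = 1 ∧ e / 3 < (c + 1) / 2) ∨ (e % 3 = 2 ∧ e / 3 + 1 < (c + 1) / 2) ∨
      (e % 3 = 1 ∧ 0 < c ∧ 2 * (e / 3) = c) := by
  constructor
  · intro h
    have heN : e < 3 * N := by
      obtain ⟨x, y, hxy, -⟩ := h
      exact hxy.1
    by_contra! hcon
    obtain ⟨h1, h2, h3⟩ := hcon
    by_cases hlt : e / 3 < (c + 1) / 2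
    · refine extremal_not_isCutEdge_of_loop ?_ h
      simp only [extremalLeft, extremalRight]
      split_ifs <;> omega
    · by_cases hd : 0 < c ∧ 2 * (e / 3) = c
      · refine extremal_not_isCutEdge_of_loop ?_ h
        simp only [extremalLeft, extremalRight]
        split_ifs <;> omega
      · -- another one of the three parallel edges
        refine extremal_not_isCutEdge_of_parallel (f := 3 * (e / 3) + (e + 1) % 3) (by omega)
          (by omega) ?_ ?_ h
        all_goals
          simp only [extremalLeft, extremalRight]
          split_ifs <;> omega
  · rintro (⟨h1, h2⟩ | ⟨h1, h2⟩ | ⟨h1, h0, h2⟩)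
    · rw [show e = 3 * (e / 3) + 1 by omega]
      exact extremal_isCutEdge_spine h2
    · rw [show e = 3 * (e / 3) + 2 by omega]
      exact extremal_isCutEdge_pendant h2
    · rw [show e = 3 * (e / 3) + 1 by omega]
      exact extremal_isCutEdge_dumbbell h0 h2

theorem extremal_ncard_cutEdgeSet : (extremal N c hc).cutEdgeSet.ncard = c := by
  -- for even `c`, the last value is the cut-edge of the dumbbell
  let φ : ℕ → ℕ := fun j =>
    if j + 1 = 2 * ((c + 1) / 2) then 3 * ((c + 1) / 2) + 1 else 3 * (j / 2) + 1 + j % 2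
  have h : (extremal N c hc).cutEdgeSet = φ '' (range c : Set ℕ) := by
    ext e
    rw [cutEdgeSet, Set.mem_ofPred_eq, extremal_isCutEdge_iff]
    simp only [Set.mem_image, Finset.mem_coe, Finset.mem_range, φ]
    constructor
    · rintro (⟨h1, h2⟩ | ⟨h1, h2⟩ | ⟨h1, h0, h2⟩)
      · exact ⟨2 * (e / 3), by omega, by split_ifs <;> omega⟩
      · exact ⟨2 * (e / 3) + 1, by omega, by split_ifs <;> omega⟩
      · exact ⟨2 * (e / 3) - 1, by omega, by split_ifs <;> omega⟩
    · rintro ⟨j, hj, rfl⟩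
      split_ifs <;> omega
  rw [h, Set.InjOn.ncard_image, Set.ncard_coe_finset, Finset.card_range]
  intro j hj k hk hjk
  simp only [Finset.mem_coe, Finset.mem_range, φ] at hj hk hjk
  split_ifs at hjk <;> omega

/-- All edges at an inner vertex of the caterpillar are cut-edges. -/
theorem extremal_notMem_of_isRegular_two {H : Graph ℕ ℕ} (hH : H ≤ extremal N c hc)
    (h2 : H.IsRegular 2) {i : ℕ} (hi : i + 1 < (c + 1) / 2) : 2 * i + 1 ∉ H.vertexSet := by
  intro hx
  have hne : (H.incidenceSet (2 * i + 1)).Nonempty := by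
    by_contra! h
    have hl : H.loopSet (2 * i + 1) = ∅ :=
      Set.subset_eq_empty (H.loopSet_subset_incidenceSet _) h
    have := h2 _ hx
    rw [degree, h, hl] at this
    simp at this
  obtain ⟨e, he⟩ := hne
  have heG := extremal_inc.1 (Inc.mono hH he)
  refine IsCutEdge.notMem_of_isRegular_two (Set.finite_lt_nat _) (Set.finite_lt_nat _) hH h2
    (extremal_isCutEdge_iff.2 ?_) (Inc.edge_mem he)
  obtain ⟨-, he⟩ := heG
  unfold extremalLeft extremalRight at he
  split_ifs at he <;> omega

theorem extremal_maxRegular_le :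
    (extremal N c hc).maxRegular 2 ≤ 2 * N - ((c + 1) / 2 - 1) := by
  obtain ⟨H, hH, h2, hcard⟩ := ((extremal N c hc).isGreatest_maxRegular 2 (Set.finite_lt_nat _)).1
  rw [← hcard]
  have hsub : H.vertexSet ⊆
      (↑(range (2 * N) \ (range ((c + 1) / 2 - 1)).image fun i => 2 * i + 1) : Set ℕ) := by
    intro x hx
    simp only [Finset.coe_sdiff, Set.mem_sdiff, Finset.mem_coe, Finset.mem_range,
      Finset.mem_image, not_exists, not_and]
    refine ⟨hH.1 hx, ?_⟩
    rintro i hi rfl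
    exact extremal_notMem_of_isRegular_two hH h2 (by omega) hx
  refine (Set.ncard_le_ncard hsub (Finset.finite_toSet _)).trans ?_
  rw [Set.ncard_coe_finset, Finset.card_sdiff_of_subset, Finset.card_range,
    Finset.card_image_of_injective _ (fun a b h => by simpa using h), Finset.card_range]
  intro x hx
  obtain ⟨i, hi, rfl⟩ := Finset.mem_image.1 hx
  rw [Finset.mem_range] at hi ⊢
  omega

end Graph

theorem theorem1 :
    -- every finite cubic multigraph satisfies the bound
    (∀ {α β : Type*} (G : Graph α β), G.vertexSet.Finite → G.edgeSet.Finite → G.IsRegular 3 →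
      (G.vertexSet.ncard : ℤ) - max 0 ⌊((G.cutEdgeSet.ncard : ℚ) - 1) / 2⌋ ≤ G.maxRegular 2) ∧
    -- the bound is attained for every even `n` and every `c < n`
    (∀ n c : ℕ, Even n → c < n →
      ∃ G : Graph ℕ ℕ, G.vertexSet.Finite ∧ G.edgeSet.Finite ∧ G.IsRegular 3 ∧
        G.vertexSet.ncard = n ∧ G.cutEdgeSet.ncard = c ∧
        (G.maxRegular 2 : ℤ) = (n : ℤ) - max 0 ⌊((c : ℚ) - 1) / 2⌋) := by
  constructor
  · intro α β G hV hE h3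
    have h := Graph.two_mul_ncard_le hV hE h3
    rw [Graph.floor_sub_one_div_two]
    omega
  · intro n c hn hcn
    obtain ⟨N, rfl⟩ := hn.exists_two_nsmul
    rw [smul_eq_mul] at hcn ⊢
    have hV : (Graph.extremal N c hcn).vertexSet.Finite := Set.finite_lt_nat _
    have hE : (Graph.extremal N c hcn).edgeSet.Finite := Set.finite_lt_nat _
    have hVc : (Graph.extremal N c hcn).vertexSet.ncard = 2 * N := by
      have : (Graph.extremal N c hcn).vertexSet = (Finset.range (2 * N) : Set ℕ) := by
        ext x
        simp [Graph.extremal]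
      rw [this, Set.ncard_coe_finset, Finset.card_range]
    have h := Graph.two_mul_ncard_le hV hE Graph.extremal_isRegular
    have hle := Graph.extremal_maxRegular_le (hc := hcn)
    rw [hVc, Graph.extremal_ncard_cutEdgeSet] at h
    refine ⟨_, hV, hE, Graph.extremal_isRegular, hVc, Graph.extremal_ncard_cutEdgeSet, ?_⟩
    rw [Graph.floor_sub_one_div_two]
    push_cast
    omega
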